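/- **Setting.** Let $(E,C)$ be a finite bipartite separated graph: $E^0=E^{0,0}\sqcup E^{0,1}$ and $E^1$ are finite, every edge $e$ goes from $s(e)\in E^{0,1}$ to $r(e)\in E^{0,0}$, $s(E^1)=E^{0,1}$, $r(E^1)=E^{0,0}$, and $C=\bigsqcup_{v\in E^{0,0}}C_v$, where $C_v$ is a partition of $r^{-1}(v)$ into nonempty sets. Assume $|C_v|\ge 2$ for all $v\in E^{0,0}$. For $e\in E^1$ let $X_e$ be the element of $C$ containing $e$. For $X\in C_v$ put $Z_X=\prod_{Y\in C_v,\,Y\ne X}Y$, with projections $\pi_Y\colon Z_X\to Y$. Let $\mathbb F$ be the free group on $E^1$. **The space.** An $(E,C)$-dynamical system is a compact Hausdorff space $\Omega=\bigsqcup_{v\in E^0}\Omega_v$ with all $\Omega_v$ clopen, together with clopen sets $H_x\subseteq\Omega_{r(x)}$ and homeomorphisms $\theta_x\colon\Omega_{s(x)}\to H_x$ ($x\in E^1$) such that $\Omega_v=\bigsqcup_{x\in X}H_x$ for all $X\in C_v$, $v\in E^{0,0}$. Equivariant maps preserve the $\Omega_v$ and the $H_x$ and commute with the $\theta_x$. $\Omega(E,C)$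 is the universal system: each system has a unique continuous equivariant map to it. For $g\in\mathbb F$ with reduced form $a_1\cdots a_k$, $\theta_g=\theta_{a_1}\circ\cdots\circ\theta_{a_k}$ (where $\theta_{x^{-1}}=\theta_x^{-1}$) with its natural domain. **$E$-functions.** A partial $E$-function based at $w\in E^{0,1}$ is a sequence $(\Omega_1,f_1),\dots,(\Omega_r,f_r)$ of sets $\Omega_j\subseteq\mathbb F$ and functions $f_j\colon\Omega_j\to\bigsqcup_{X\in C}Z_X$ such that (1) $\Omega_1=s^{-1}(w)$ and $f_1(e)\in Z_{X_e}$; (2) for $j\ge2$, $\Omega_j$ is the set of all $e\,e'^{-1}g$ with $g\in\Omega_{j-1}$, $e'=\pi_Y(f_{j-1}(g))$ for some factor $Y$ of the product $Z_X$ containing $f_{j-1}(g)$, and $e\in E^1$, $s(e)=s(e')$, $e\neq e'$; (3) $f_j(e\,e'^{-1}g)\in Z_{X_e}$ for all such elements. (The sets $\Omega_j$ are then finite.) An $E$-function based at $w$ is an infinite sequence $(\Omega_1,f_1),(\Omega_2,f_2),\dots$ with these properties. **The complete multiresolution.** Put $(E_0,C^0)=(E,C)$. Given $(E_n,C^n)$,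 let $E_{n+1}^{0,0}=E_n^{0,1}$; let $E_{n+1}^{0,1}$ be the set of vertices $v(x_1,\dots,x_k)$ with $(x_1,\dots,x_k)\in X_1\times\dots\times X_k$, where $C^n_u=\{X_1,\dots,X_k\}$, $u\in E_n^{0,0}$; let the edges of $E_{n+1}$ be $\alpha^{x_i}(x_1,\dots,\widehat{x_i},\dots,x_k)$, going from $v(x_1,\dots,x_k)$ to $s(x_i)$; and let $C^{n+1}_{z}=\{X(x)\mid s(x)=z\}$, where $X(x)$ is the set of all edges $\alpha^{x}(\dots)$. Put $D_n=E_n^{0,0}$. The complete multiresolution $F_\infty$ is the union of the $(E_n,C^n)$, with $F_\infty^0=\bigsqcup_{n\ge0}D_n$. The root map $D_{2r+1}\to D_1=E^{0,1}$ is the $r$-fold iteration of $v(x_1,\dots,x_k)\mapsto u$. A vertex $v$ of $F_\infty$ corresponds to the following subset $\Omega_v$ of $\Omega(E,C)$. For $v\in D_0\cup D_1=E^0$ it is the given one, and for $v=v(x_1,\dots,x_k)\in D_{n+2}$, with $x_i \in E_n^1$, it is $\Omega_v=H_{x_1}\cap\dots\cap H_{x_k}$. Here, for edges of $E_0$, $H_x$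 and $\theta_x$ are the given ones, and for an edge $\alpha=\alpha^{x_i}(x_1,\dots,\widehat{x_i},\dots,x_k)$ of $E_{n+1}$ one lets $\theta_\alpha$ be the restriction of $\theta_{x_i}^{-1}$ to $\Omega_{v(x_1,\dots,x_k)}$ and $H_\alpha$ its image. **Theorem 8.3.** The universal system $\Omega(E,C)$ exists, and for every $w\in E^{0,1}$ there is a bijection $\xi\mapsto\mathfrak f^\xi=((\Omega_1^\xi,f_1^\xi),(\Omega_2^\xi,f_2^\xi),\dots)$ from $\Omega(E,C)_w$ onto the set of $E$-functions based at $w$ (that is, with $\Omega_1=s^{-1}(w)$), which records the dynamics of the points: for all $j\ge1$, $g\in\Omega_j^\xi$ and all factors $Y$ of the product $Z_X$ containing $f^\xi_j(g)$, the point $\theta_g(\xi)$ is defined and lies in $H_y$, where $y=\pi_Y(f_j^\xi(g))$. For a partial $E$-function $\mathfrak g$ of length $r\ge1$ based at $w$, let $U_{\mathfrak g}$ be the set of all $\xi\in\Omega(E,C)_w$ such that $\mathfrak f^\xi$ begins with $\mathfrak g$. Then: 1. Every $U_{\mathfrak g}$ is clopen in $\Omega(E,C)$, and for every $\xi\in\Omega(E,C)_w$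 the sets $U_{\mathfrak g}$, where $\mathfrak g=((\Omega_1^\xi,f_1^\xi),\dots,(\Omega_r^\xi,f_r^\xi))$, $r\ge1$, form a fundamental system of neighbourhoods of $\xi$ in $\Omega(E,C)$. 2. For every $r\ge1$ there is a bijection $\mathfrak g\mapsto v_{\mathfrak g}$ from the set of partial $E$-functions of length $r$ based at $w$ onto the set of vertices with root $w$ in the layer $D_{2r+1}$ of $F_\infty$, such that $U_{\mathfrak g}=\Omega_{v_{\mathfrak g}}$. -/

import Mathlib

universe u

open scoped Topology

/-- A separated graph `(E, C)`.  The partition `C_v` of `r⁻¹(v)` is given as an indexed family: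
`C` is the index set of all the blocks (over all vertices), `base X` is the vertex `v` with
`X ∈ C_v`, and `grp e` is the unique block `X_e` containing the edge `e`.  So the block `X` is the
set `{e | grp e = X}`; surjectivity of `grp` says that the blocks are nonempty. -/
structure SepGraph where
  V : Type u
  Edge : Type u
  C : Type u
  s : Edge → V
  r : Edge → V
  base : C → V
  grp : Edge → C
  r_eq : ∀ e, r e = base (grp e)
  grp_surj : Function.Surjective grp

/-- A bipartite separated graph: `E⁰ = V0 ⊔ V1` (for `E^{0,0}` and `E^{0,1}`), every edge goes from
`V1` to `V0`, `s(E¹) = E^{0,1}` and `r(E¹) = E^{0,0}`.  The separation is given as for `SepGraph`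
(vertices in `V1` receive no edge, so there are no blocks at them). -/
structure BipSepGraph where
  V0 : Type u
  V1 : Type u
  Edge : Type u
  C : Type u
  s : Edge → V1
  base : C → V0
  grp : Edge → C
  grp_surj : Function.Surjective grp
  base_surj : Function.Surjective base
  s_surj : Function.Surjective s

namespace BipSepGraph

/-- The range map. -/
def r (E : BipSepGraph.{u}) (e : E.Edge) : E.V0 := E.base (E.grp e)

/-- The set of blocks `C_v`. -/
abbrev Cat (E : BipSepGraph.{u}) (v : E.V0) : Type u := {X : E.C // E.base X = v}

/-- The block `X`, as a set of edges. -/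
abbrev Blk (E : BipSepGraph.{u}) (X : E.C) : Type u := {e : E.Edge // E.grp e = X}

/-- The blocks `Y ≠ X` that lie in the same `C_v` as `X`. -/
abbrev Others (E : BipSepGraph.{u}) (X : E.C) : Type u := {Y : E.C // E.base Y = E.base X ∧ Y ≠ X}

/-- `Z_X = ∏_{Y ∈ C_v, Y ≠ X} Y` for `X ∈ C_v`.  For `z : E.Z X` the value `z Y` is `π_Y z`. -/
abbrev Z (E : BipSepGraph.{u}) (X : E.C) : Type u := ∀ Y : E.Others X, E.Blk Y.1

/-- `⊔_{X ∈ C} Z_X`. -/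
abbrev Choice (E : BipSepGraph.{u}) : Type u := Σ X : E.C, E.Z X

/-! ### The complete multiresolution -/

open scoped Classical in
/-- The tuple `(x_1, …, x_k) ∈ ∏_{X ∈ C_{r(x)}} X` obtained by inserting `x` into
`z = (x_1, …, x̂, …, x_k) ∈ Z_{X_x}`. -/
noncomputable def fill (E : BipSepGraph.{u}) (x : E.Edge) (z : E.Z (E.grp x)) :
    ∀ X : E.Cat (E.r x), E.Blk X.1 :=
  fun X => if h : X.1 = E.grp x then ⟨x, h.symm⟩ else z ⟨X.1, X.2, h⟩

theorem exists_z (E : BipSepGraph.{u}) (X : E.C) : Nonempty (E.Z X) :=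
  ⟨fun Y => ⟨(E.grp_surj Y.1).choose, (E.grp_surj Y.1).choose_spec⟩⟩

theorem fill_eq (E : BipSepGraph.{u}) (x : E.Edge) (t : ∀ X : E.Cat (E.r x), E.Blk X.1)
    (h : (t ⟨E.grp x, rfl⟩).1 = x) : E.fill x (fun Y => t ⟨Y.1, Y.2.1⟩) = t := by
  funext Y
  unfold fill
  by_cases hY : Y.1 = E.grp x
  · rw [dif_pos hY]
    obtain ⟨Y, _⟩ := Y
    dsimp only at hY
    subst hY
    exact Subtype.ext h.symm
  · rw [dif_neg hY]

/-- The bipartite separated graph `(E_1, C^1)` formed by the new layer of the multiresolution of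
`(E, C)` at `E^{0,0}`:
* `E_1^{0,0} = E^{0,1}`;
* `E_1^{0,1}` is the set of the new vertices `v(x_1, …, x_k)`, where `(x_i) ∈ ∏_{X ∈ C_u} X`,
  `u ∈ E^{0,0}`;
* `E_1^1` is the set of the new arrows `α^x(x_1, …, x̂, …, x_k)`, where
  `(x_1, …, x̂, …, x_k) ∈ Z_{X_x}`, with source `v(x_1, …, x, …, x_k)` and range `s(x)`;
* its blocks are the sets `X(x) = {α^x(z) | z ∈ Z_{X_x}} ∈ C^1_{s(x)}`, indexed by `x ∈ E¹`. -/
noncomputable def next (E : BipSepGraph.{u}) : BipSepGraph.{u} where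
  V0 := E.V1
  V1 := Σ v : E.V0, ∀ X : E.Cat v, E.Blk X.1
  Edge := Σ x : E.Edge, E.Z (E.grp x)
  C := E.Edge
  s a := ⟨E.r a.1, E.fill a.1 a.2⟩
  base := E.s
  grp a := a.1
  grp_surj x := ⟨⟨x, (E.exists_z (E.grp x)).some⟩, rfl⟩
  base_surj := E.s_surj
  s_surj := by
    have key : ∀ (X : E.C) (t : ∀ Y : E.Cat (E.base X), E.Blk Y.1) (y : E.Edge)
        (_ : E.grp y = X) (_ : (t ⟨X, rfl⟩).1 = y),
        ∃ a : Σ x : E.Edge, E.Z (E.grp x),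
          (⟨E.r a.1, E.fill a.1 a.2⟩ : Σ v : E.V0, ∀ X : E.Cat v, E.Blk X.1) = ⟨E.base X, t⟩ := by
      intro X t y hy ht
      subst hy
      exact ⟨⟨y, fun Y => t ⟨Y.1, Y.2.1⟩⟩, Sigma.ext rfl (heq_of_eq (E.fill_eq y t ht))⟩
    rintro ⟨v, t⟩
    obtain ⟨X, rfl⟩ := E.base_surj v
    exact key X t _ (t ⟨X, rfl⟩).2 rfl

/-- The canonical sequence `(E_n, C^n)` of bipartite separated graphs. -/
noncomputable def seq (E : BipSepGraph.{u}) : ℕ → BipSepGraph.{u}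
  | 0 => E
  | n + 1 => (E.seq n).next

/-- The layer `D_n = F^{0,n} = E_n^{0,0}`.  By definition `D_{n+1} = E_n^{0,1}`. -/
abbrev D (E : BipSepGraph.{u}) (n : ℕ) : Type u := (E.seq n).V0

/-- The complete multiresolution `(F_∞, D^∞)`: its vertices are `⊔_n D_n`, its edges `⊔_n E_n^1`,
and its blocks at a vertex of `D_n` are those of `(E_n, C^n)`. -/
noncomputable def FInfty (E : BipSepGraph.{u}) : SepGraph.{u} where
  V := Σ n : ℕ, E.D n
  Edge := Σ n : ℕ, (E.seq n).Edge
  C := Σ n : ℕ, (E.seq n).C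
  s e := ⟨e.1 + 1, (E.seq e.1).s e.2⟩
  r e := ⟨e.1, (E.seq e.1).r e.2⟩
  base X := ⟨X.1, (E.seq X.1).base X.2⟩
  grp e := ⟨e.1, (E.seq e.1).grp e.2⟩
  r_eq _ := rfl
  grp_surj := by
    rintro ⟨n, X⟩
    obtain ⟨e, rfl⟩ := (E.seq n).grp_surj X
    exact ⟨⟨n, e⟩, rfl⟩

/-- The map `r_{n+2} : D_{n+2} → D_n`, `v(x_1, …, x_k) ↦ u`, where `x_i ∈ X_i`,
`C_u = {X_1, …, X_k}`. -/
def parent (E : BipSepGraph.{u}) (n : ℕ) (v : E.D (n + 2)) : E.D n :=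
  Sigma.fst (show (E.seq n).next.V1 from v)

/-- The root map `D_{2m+1} → D_1 = E^{0,1}`, the composition `r_3 ∘ r_5 ∘ ⋯ ∘ r_{2m+1}`. -/
def root (E : BipSepGraph.{u}) : (m : ℕ) → E.D (2 * m + 1) → E.V1
  | 0, w => w
  | m + 1, v => E.root m (E.parent (2 * m + 1) v)

/-! ### `E`-functions

A pair `(Ω_j, f_j)`, where `Ω_j` is a subset of the free group `𝔽` on `E¹` and
`f_j : Ω_j → ⊔_{X ∈ C} Z_X` is a function, is encoded as one partial function `f_j` on `𝔽` (a
function with values in `Option`) with domain `Ω_j`. -/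

/-- Pairs `(Ω_j, f_j)`. -/
abbrev LocalFun (E : BipSepGraph.{u}) : Type u := FreeGroup E.Edge → Option E.Choice

/-- The set `Ω_j` on which `f_j` is defined. -/
def dom (E : BipSepGraph.{u}) (f : E.LocalFun) : Set (FreeGroup E.Edge) :=
  {g | ∃ c, f g = some c}

/-- The requirements on `(Ω_1, f_1)`: `Ω_1 = s⁻¹(w)`, and `f_1(e) ∈ Z_{X_e}` for `e ∈ Ω_1`. -/
def IsFirst (E : BipSepGraph.{u}) (w : E.V1) (f : E.LocalFun) : Prop :=
  E.dom f = {g | ∃ e, E.s e = w ∧ g = FreeGroup.of e} ∧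
  ∀ e c, f (FreeGroup.of e) = some c → c.1 = E.grp e

/-- The requirements on `(Ω_j, f_j)`, given `(Ω_{j-1}, f_{j-1})`: the set `Ω_j` consists of the
elements `e · (e')⁻¹ · g`, where `g ∈ Ω_{j-1}`, `e' = π_Y (f_{j-1}(g))` for a factor `Y` of `Z_X`,
`f_{j-1}(g) ∈ Z_X`, and `s(e) = s(e')`, `e ≠ e'`; moreover `f_j(e · (e')⁻¹ · g) ∈ Z_{X_e}`. -/
def IsNext (E : BipSepGraph.{u}) (f f' : E.LocalFun) : Prop :=
  E.dom f' = {h | ∃ g c, f g = some c ∧ ∃ Y : E.Others c.1, ∃ e, E.s e = E.s (c.2 Y).1 ∧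
    e ≠ (c.2 Y).1 ∧ h = FreeGroup.of e * (FreeGroup.of (c.2 Y).1)⁻¹ * g} ∧
  ∀ g c, f g = some c → ∀ Y : E.Others c.1, ∀ e, E.s e = E.s (c.2 Y).1 → e ≠ (c.2 Y).1 →
    ∀ c', f' (FreeGroup.of e * (FreeGroup.of (c.2 Y).1)⁻¹ * g) = some c' → c'.1 = E.grp e

/-- The partial `E`-functions `(Ω_1, f_1), …, (Ω_r, f_r)` with `Ω_1 = s⁻¹(w)`; `f j` stands for
`(Ω_{j+1}, f_{j+1})`. -/
@[ext] structure PartialEFunction (E : BipSepGraph.{u}) (w : E.V1) (r : ℕ) where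
  f : Fin r → E.LocalFun
  first : ∀ h : 0 < r, E.IsFirst w (f ⟨0, h⟩)
  step : ∀ (j : ℕ) (h : j + 1 < r), E.IsNext (f ⟨j, Nat.lt_of_succ_lt h⟩) (f ⟨j + 1, h⟩)

/-- The `E`-functions `(Ω_1, f_1), (Ω_2, f_2), …` with `Ω_1 = s⁻¹(w)`; `f j` stands for
`(Ω_{j+1}, f_{j+1})`. -/
@[ext] structure EFunction (E : BipSepGraph.{u}) (w : E.V1) where
  f : ℕ → E.LocalFun
  first : E.IsFirst w (f 0)
  step : ∀ j, E.IsNext (f j) (f (j + 1))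

/-- The partial `E`-function `(Ω_1, f_1), …, (Ω_r, f_r)` formed by the first `r` terms of an
`E`-function. -/
def EFunction.truncate {E : BipSepGraph.{u}} {w : E.V1} (𝔣 : E.EFunction w) (r : ℕ) :
    E.PartialEFunction w r where
  f j := 𝔣.f j
  first _ := 𝔣.first
  step j _ := 𝔣.step j

/-! ### `(E, C)`-dynamical systems -/

/-- An `(E, C)`-dynamical system: a compact Hausdorff space `Pt` which is the disjoint union of
clopen sets `Ω_v`, `v ∈ E⁰ = E^{0,0} ⊔ E^{0,1}`, and homeomorphisms `θ_x : Ω_{s(x)} → H_x`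
(`x ∈ E¹`) onto clopen subsets `H_x ⊆ Ω_{r(x)}` such that `Ω_v = ⊔_{x ∈ X} H_x` for all `X ∈ C_v`.
A homeomorphism between two clopen subsets of `Pt` is an `OpenPartialHomeomorph`; the clopen set
`H_x` is the target of `θ_x`. -/
structure DynSystem (E : BipSepGraph.{u}) where
  Pt : Type u
  [top : TopologicalSpace Pt]
  [compact : CompactSpace Pt]
  [t2 : T2Space Pt]
  Ω : E.V0 ⊕ E.V1 → Set Pt
  isClopen_Ω : ∀ v, IsClopen (Ω v)
  Ω_cover : ∀ p, ∃! v, p ∈ Ω v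
  θ : E.Edge → OpenPartialHomeomorph Pt Pt
  source_θ : ∀ x, (θ x).source = Ω (Sum.inr (E.s x))
  isClopen_target : ∀ x, IsClopen (θ x).target
  iUnion_target : ∀ X : E.C, ⋃ x : E.Blk X, (θ x.1).target = Ω (Sum.inl (E.base X))
  disjoint_target : ∀ x y, E.grp x = E.grp y → x ≠ y → Disjoint (θ x).target (θ y).target

attribute [instance] DynSystem.top DynSystem.compact DynSystem.t2

namespace DynSystem

variable {E : BipSepGraph.{u}}

/-- The clopen set `H_x`. -/
def H (S : E.DynSystem) (x : E.Edge) : Set S.Pt := (S.θ x).target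

/-- Equivariant maps between `(E, C)`-dynamical systems. -/
def IsEquivariant (S T : E.DynSystem) (f : S.Pt → T.Pt) : Prop :=
  (∀ v, ∀ p ∈ S.Ω v, f p ∈ T.Ω v) ∧ (∀ x, ∀ p ∈ S.H x, f p ∈ T.H x) ∧
  ∀ x, ∀ p ∈ S.Ω (Sum.inr (E.s x)), f (S.θ x p) = T.θ x (f p)

/-- `S` is the universal `(E, C)`-dynamical system `Ω(E, C)`: every `(E, C)`-dynamical system has a
unique continuous equivariant map to it. -/
def IsUniversal (S : E.DynSystem) : Prop :=
  ∀ T : E.DynSystem, ∃! f : C(T.Pt, S.Pt), IsEquivariant T S f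

/-- The composition `θ_{a_1} ∘ θ_{a_2} ∘ ⋯ ∘ θ_{a_k}` for a word `a_1 a_2 ⋯ a_k` in the letters
`(x, true) = x` and `(x, false) = x⁻¹`, with its natural domain. -/
def wordAction (S : E.DynSystem) : List (E.Edge × Bool) → PartialEquiv S.Pt S.Pt
  | [] => PartialEquiv.refl S.Pt
  | (x, true) :: L => (wordAction S L).trans (S.θ x).toPartialEquiv
  | (x, false) :: L => (wordAction S L).trans (S.θ x).symm.toPartialEquiv

open scoped Classical in
/-- The partial action of the free group `𝔽` on `E¹`: `θ_g = θ_{a_1} ∘ ⋯ ∘ θ_{a_k}`, where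
`a_1 ⋯ a_k` is the reduced form of `g`. -/
noncomputable def action (S : E.DynSystem) (g : FreeGroup E.Edge) : PartialEquiv S.Pt S.Pt :=
  S.wordAction g.toWord

/-- The partial maps defined by the edges of the canonical sequence `(E_n, C^n)` on an
`(E, C)`-dynamical system, turning it into an `(E_n, C^n)`-dynamical system.  For `n = 0` they are
the `θ_x`.  For an edge `α = α^x(x_1, …, x̂, …, x_k)` of `E_{n+1}`, with source the vertex
`v(x_1, …, x_k)`, the map is the restriction of `θ_x⁻¹` to the set `H_{x_1} ∩ ⋯ ∩ H_{x_k}`. -/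
noncomputable def edgeMap (S : E.DynSystem) :
    (n : ℕ) → (E.seq n).Edge → PartialEquiv S.Pt S.Pt
  | 0, x => (S.θ x).toPartialEquiv
  | n + 1, α =>
    let a : Σ x : (E.seq n).Edge, (E.seq n).Z ((E.seq n).grp x) := α
    (S.edgeMap n a.1).symm.restr
      (⋂ X, (S.edgeMap n ((E.seq n).fill a.1 a.2 X).1).target)

/-- The subset of an `(E, C)`-dynamical system belonging to a vertex of the layer `D_n`: it is
`Ω_v` for `v ∈ D_0 ∪ D_1`, and `H_{x_1} ∩ ⋯ ∩ H_{x_k}` for the vertex `v(x_1, …, x_k)` of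
`D_{n+2}`, where `x_1, …, x_k` are edges of `E_n`.  In terms of projections, this says that the
vertex `v(x_1, …, x_k)` is the product of the `x_i x_i^*`. -/
noncomputable def layerSet (S : E.DynSystem) : (n : ℕ) → E.D n → Set S.Pt
  | 0, v => S.Ω (Sum.inl v)
  | 1, w => S.Ω (Sum.inr w)
  | n + 2, v =>
    let t : Σ u : (E.seq n).V0, ∀ X : (E.seq n).Cat u, (E.seq n).Blk X.1 := v
    ⋂ X, (S.edgeMap n (t.2 X).1).target

/-- The subset of `Ω(E, C)` corresponding to a vertex of `F_∞`. -/
noncomputable def vertexSet (S : E.DynSystem) (v : E.FInfty.V) : Set S.Pt :=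
  S.layerSet v.1 v.2

/-- The `E`-function `𝔣` records the dynamics of the point `ξ`: for all `j`, all `g ∈ Ω_j` and all
factors `Y` of the product `Z_X` containing `f_j(g)`, the point `θ_g(ξ)` is defined and lies in
`H_y`, where `y = π_Y (f_j(g)) ∈ Y`. -/
def Records (S : E.DynSystem) {w : E.V1} (ξ : S.Pt) (𝔣 : E.EFunction w) : Prop :=
  ∀ j g c, 𝔣.f j g = some c → ξ ∈ (S.action g).source ∧
    ∀ Y : E.Others c.1, S.action g ξ ∈ S.H (c.2 Y).1

/-- Given a correspondence `Φ` between the points of `Ω_w` and `E`-functions, the set of points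
represented by a partial `E`-function `𝔤 = ((Ω_1, f_1), …, (Ω_r, f_r))`: the points of `Ω_w` whose
`E`-function starts with `𝔤`. -/
def cylinder (S : E.DynSystem) {w : E.V1} (Φ : S.Ω (Sum.inr w) → E.EFunction w) {r : ℕ}
    (𝔤 : E.PartialEFunction w r) : Set S.Pt :=
  {ξ | ∃ h : ξ ∈ S.Ω (Sum.inr w), (Φ ⟨ξ, h⟩).truncate r = 𝔤}

end DynSystem

end BipSepGraph

/-! A point is studied through its code: the function sending a word `L` in the edges and their
inverses to the class in E^0 of its image under `L`, where that image exists. Codes involve no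
topology, so most of the argument runs on set-level systems (`Flow`), which are easy to construct.
The functions that are codes satisfy axioms each involving finitely many words, so they form a
closed subset of a product of finite discrete spaces, hence a compact system. Equivariant maps
preserve codes, which makes this system universal (`CodeSpace.isUniversal_system`). It follows that
every flow maps to any universal system (`IsUniversal.exists_hom`), and that points of a universal
system are determined by their codes (`IsUniversal.code_injective`).

The finite objects of the theorem all measure agreement of codes on words of bounded length. Passing
from (E_n, C^n) to (E_{n+1}, C^{n+1}) refines the class of a point by exactly one letter
(`agree_up`), so points have the same class in E_n iff their codes agree up to length n
(`cls_iter_eq_iff`). On the other side, f_j is indexed by reduced words of length 2j-1 and names the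
edges along which one may go back, that is, words of length 2j; forward letters are forced by the
class. Hence the first r terms of an E-function carry the same information as the code up to length
2r (`forall_eq_iff_agree`), as does the vertex in D_{2r+1} = E_{2r}^{0,1}.

For existence, a full or partial E-function prescribes choices on a tree of reduced words; the tree
is a flow, and the image of its root in the universal system realizes the function
(`IsUniversal.exists_realization`). Every vertex of every layer is inhabited because each E_n has a
flow in which all classes occur, and this flow comes from one for E (`IsUniversal.exists_cls_iter`).
Cylinders and vertex sets are then the classes of one equivalence relation, and compactness turns
separation of points by codes into a neighbourhood basis. -/

namespace BipSepGraph

/-! ### Set-level systems and codes of points -/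

/-- A set-level `(E, C)`-dynamical system: points with a class in `E⁰`, and relations
`R x p q`, expressing that `θ_x p = q`. -/
structure Flow (E : BipSepGraph.{u}) where
  Pt : Type u
  cls : Pt → E.V0 ⊕ E.V1
  R : E.Edge → Pt → Pt → Prop
  cls_left : ∀ {x p q}, R x p q → cls p = Sum.inr (E.s x)
  cls_right : ∀ {x p q}, R x p q → cls q = Sum.inl (E.r x)
  exists_fwd : ∀ {x p}, cls p = Sum.inr (E.s x) → ∃ q, R x p q
  unique_fwd : ∀ {x p q q'}, R x p q → R x p q' → q = q'
  exists_bwd : ∀ {X q}, cls q = Sum.inl (E.base X) → ∃ x p, E.grp x = X ∧ R x p q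
  unique_bwd : ∀ {x x' p p' q}, R x p q → R x' p' q → E.grp x = E.grp x' → x = x' ∧ p = p'

namespace Flow

variable {E : BipSepGraph.{u}}

/-- One step along a letter `x` or `x⁻¹`. -/
def Step (F : E.Flow) : E.Edge × Bool → F.Pt → F.Pt → Prop
  | (x, true), p, q => F.R x p q
  | (x, false), p, q => F.R x q p

/-- `F.Reach L p q` says that `θ_L p` is defined and equal to `q`. -/
def Reach (F : E.Flow) : List (E.Edge × Bool) → F.Pt → F.Pt → Prop
  | [], p, q => p = q
  | a :: L, p, q => ∃ m, F.Reach L p m ∧ F.Step a m q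

theorem Step.unique {F : E.Flow} {a : E.Edge × Bool} {p q q' : F.Pt} (h : F.Step a p q)
    (h' : F.Step a p q') : q = q' := by
  obtain ⟨x, _ | _⟩ := a
  · exact (F.unique_bwd h h' rfl).2
  · exact F.unique_fwd h h'

theorem Step.cls_eq {F G : E.Flow} {a : E.Edge × Bool} {p q : F.Pt} {p' q' : G.Pt}
    (h : F.Step a p q) (h' : G.Step a p' q') : F.cls q = G.cls q' := by
  obtain ⟨x, _ | _⟩ := a
  · exact (F.cls_left h).trans (G.cls_left h').symm
  · exact (F.cls_right h).trans (G.cls_right h').symm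

theorem Reach.unique {F : E.Flow} {L : List (E.Edge × Bool)} {p q q' : F.Pt}
    (h : F.Reach L p q) (h' : F.Reach L p q') : q = q' := by
  induction L generalizing q q' with
  | nil => exact h.symm.trans h'
  | cons a L ih =>
    obtain ⟨m, hm, hs⟩ := h
    obtain ⟨m', hm', hs'⟩ := h'
    obtain rfl := ih hm hm'
    exact hs.unique hs'

theorem reach_append_singleton {F : E.Flow} {L : List (E.Edge × Bool)} {a : E.Edge × Bool}
    {p q : F.Pt} : F.Reach (L ++ [a]) p q ↔ ∃ m, F.Step a p m ∧ F.Reach L m q := by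
  induction L generalizing q with
  | nil => simp [Reach]
  | cons b L ih =>
    simp only [List.cons_append, Reach, ih]
    constructor
    · rintro ⟨m, ⟨m', h1, h2⟩, h3⟩
      exact ⟨m', h1, m, h2, h3⟩
    · rintro ⟨m', h1, m, h2, h3⟩
      exact ⟨m, ⟨m', h1, h2⟩, h3⟩

open scoped Classical in
/-- The code of a point: the class of `θ_L p`, for all words `L` for which it is defined. -/
noncomputable def code (F : E.Flow) (p : F.Pt) (L : List (E.Edge × Bool)) :
    Option (E.V0 ⊕ E.V1) :=
  if h : ∃ q, F.Reach L p q then some (F.cls h.choose) else none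

theorem code_eq_some {F : E.Flow} {p : F.Pt} {L : List (E.Edge × Bool)} {v : E.V0 ⊕ E.V1} :
    F.code p L = some v ↔ ∃ q, F.Reach L p q ∧ F.cls q = v := by
  unfold code
  split_ifs with h
  · rw [Option.some_inj]
    exact ⟨fun e => ⟨_, h.choose_spec, e⟩, fun ⟨q, hq, e⟩ => by rw [h.choose_spec.unique hq, e]⟩
  · simp only [false_iff]
    exact fun ⟨q, hq, _⟩ => h ⟨q, hq⟩

theorem Reach.code {F : E.Flow} {p q : F.Pt} {L : List (E.Edge × Bool)} (h : F.Reach L p q) :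
    F.code p L = some (F.cls q) := code_eq_some.2 ⟨q, h, rfl⟩

theorem code_eq_none {F : E.Flow} {p : F.Pt} {L : List (E.Edge × Bool)} :
    F.code p L = none ↔ ¬ ∃ q, F.Reach L p q := by
  unfold Flow.code
  split_ifs with h <;> simp [h]

theorem code_ne_none {F : E.Flow} {p : F.Pt} {L : List (E.Edge × Bool)} :
    F.code p L ≠ none ↔ ∃ q, F.Reach L p q := by
  rw [Ne, code_eq_none, not_not]

theorem code_eq_code {F G : E.Flow} {p : F.Pt} {q : G.Pt} {L M : List (E.Edge × Bool)}
    (h : ∀ m, F.Reach L p m → ∃ m', G.Reach M q m' ∧ F.cls m = G.cls m')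
    (h' : ∀ m', G.Reach M q m' → ∃ m, F.Reach L p m) : F.code p L = G.code q M := by
  by_cases H : ∃ m, F.Reach L p m
  · obtain ⟨m, hm⟩ := H
    obtain ⟨m', hm', e⟩ := h m hm
    rw [hm.code, hm'.code, e]
  · rw [code_eq_none.2 H, code_eq_none.2 fun ⟨m', hm'⟩ => H (h' m' hm')]

@[simp] theorem code_nil (F : E.Flow) (p : F.Pt) : F.code p [] = some (F.cls p) :=
  Reach.code rfl

theorem Step.code_append {F : E.Flow} {p p' : F.Pt} {a : E.Edge × Bool} (h : F.Step a p p')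
    (L : List (E.Edge × Bool)) : F.code p (L ++ [a]) = F.code p' L := by
  refine code_eq_code (fun m hm => ?_) fun m hm => ⟨m, reach_append_singleton.2 ⟨p', h, hm⟩⟩
  obtain ⟨m', h1, h2⟩ := reach_append_singleton.1 hm
  obtain rfl := h.unique h1
  exact ⟨m, h2, rfl⟩

theorem code_append_eq_none {F : E.Flow} {p : F.Pt} {a : E.Edge × Bool}
    (h : ¬ ∃ p', F.Step a p p') (L : List (E.Edge × Bool)) : F.code p (L ++ [a]) = none := by
  refine code_eq_none.2 fun ⟨m, hm⟩ => ?_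
  obtain ⟨m', h1, -⟩ := reach_append_singleton.1 hm
  exact h ⟨m', h1⟩

/-- The codes of two points agree on all words of length at most `n`. -/
def Agree (F : E.Flow) (n : ℕ) (p q : F.Pt) : Prop :=
  ∀ L : List (E.Edge × Bool), L.length ≤ n → F.code p L = F.code q L

theorem Agree.mono {F : E.Flow} {m n : ℕ} (h : m ≤ n) {p q : F.Pt} (H : F.Agree n p q) :
    F.Agree m p q := fun L hL => H L (hL.trans h)

theorem Agree.symm {F : E.Flow} {n : ℕ} {p q : F.Pt} (H : F.Agree n p q) :
    F.Agree n q p := fun L hL => (H L hL).symm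

theorem Agree.cls_eq {F : E.Flow} {n : ℕ} {p q : F.Pt} (H : F.Agree n p q) :
    F.cls p = F.cls q := by
  simpa using H [] (Nat.zero_le _)

theorem agree_zero {F : E.Flow} {p q : F.Pt} : F.Agree 0 p q ↔ F.cls p = F.cls q := by
  refine ⟨Agree.cls_eq, fun h L hL => ?_⟩
  obtain rfl := List.length_eq_zero_iff.1 (Nat.le_zero.1 hL)
  simpa using h

theorem code_singleton_ne_none {F : E.Flow} {p : F.Pt} {a : E.Edge × Bool} :
    F.code p [a] ≠ none ↔ ∃ p', F.Step a p p' := by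
  rw [code_ne_none]
  simp [Reach]

/-- The last letter of a list acts first. Splitting it off reduces agreement to the points one step
away and makes induction on the length possible. -/
theorem agree_succ {F : E.Flow} {n : ℕ} {p q : F.Pt} : F.Agree (n + 1) p q ↔
    F.cls p = F.cls q ∧ ∀ a, ((∃ p', F.Step a p p') ↔ ∃ q', F.Step a q q') ∧
      ∀ p' q', F.Step a p p' → F.Step a q q' → F.Agree n p' q' := by
  constructor
  · refine fun H => ⟨H.cls_eq, fun a => ⟨?_, fun p' q' hp hq L hL => ?_⟩⟩
    · rw [← code_singleton_ne_none, ← code_singleton_ne_none, H [a] (by simp)]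
    · rw [← hp.code_append, ← hq.code_append]
      exact H _ (by simpa using hL)
  · rintro ⟨h0, H⟩ L hL
    obtain rfl | ⟨M, a, rfl⟩ := List.eq_nil_or_concat' L
    · simpa using h0
    · by_cases hp : ∃ p', F.Step a p p'
      · obtain ⟨q', hq⟩ := (H a).1.1 hp
        obtain ⟨p', hp⟩ := hp
        rw [hp.code_append, hq.code_append]
        exact (H a).2 p' q' hp hq M (by simpa using hL)
      · rw [code_append_eq_none hp, code_append_eq_none (fun h => hp ((H a).1.2 h))]

/-- Equivariant maps between flows. -/
structure Hom (F G : E.Flow) (f : F.Pt → G.Pt) : Prop where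
  cls : ∀ p, G.cls (f p) = F.cls p
  R : ∀ {x p q}, F.R x p q → G.R x (f p) (f q)

namespace Hom

variable {F G K : E.Flow} {f : F.Pt → G.Pt} {g : G.Pt → K.Pt}

theorem comp (hg : G.Hom K g) (hf : F.Hom G f) : F.Hom K (g ∘ f) :=
  ⟨fun p => (hg.cls _).trans (hf.cls p), fun h => hg.R (hf.R h)⟩

theorem step (hf : F.Hom G f) {a : E.Edge × Bool} {p q : F.Pt} (h : F.Step a p q) :
    G.Step a (f p) (f q) := by
  obtain ⟨x, _ | _⟩ := a <;> exact hf.R h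

/-- The source flow already has a step in the required direction: the forward one, or the backward
one in the block of `x`. Its image must be the given step, by uniqueness in `G`. -/
theorem lift_step (hf : F.Hom G f) {a : E.Edge × Bool} {p : F.Pt} {r : G.Pt}
    (h : G.Step a (f p) r) : ∃ q, F.Step a p q ∧ f q = r := by
  obtain ⟨x, _ | _⟩ := a
  · obtain ⟨x', q, hx, hq⟩ := F.exists_bwd ((hf.cls p).symm.trans (G.cls_right h))
    obtain ⟨rfl, e⟩ := G.unique_bwd (hf.R hq) h hx
    exact ⟨q, hq, e⟩
  · obtain ⟨q, hq⟩ := F.exists_fwd ((hf.cls p).symm.trans (G.cls_left h))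
    exact ⟨q, hq, G.unique_fwd (hf.R hq) h⟩

theorem reach (hf : F.Hom G f) {L : List (E.Edge × Bool)} {p q : F.Pt} (h : F.Reach L p q) :
    G.Reach L (f p) (f q) := by
  induction L generalizing q with
  | nil => exact congrArg f h
  | cons a L ih =>
    obtain ⟨m, h1, h2⟩ := h
    exact ⟨f m, ih h1, hf.step h2⟩

theorem lift_reach (hf : F.Hom G f) {L : List (E.Edge × Bool)} {p : F.Pt} {r : G.Pt}
    (h : G.Reach L (f p) r) : ∃ q, F.Reach L p q ∧ f q = r := by
  induction L generalizing r with
  | nil => exact ⟨p, rfl, h⟩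
  | cons a L ih =>
    obtain ⟨m, h1, h2⟩ := h
    obtain ⟨m, h3, rfl⟩ := ih h1
    obtain ⟨q, h4, rfl⟩ := hf.lift_step h2
    exact ⟨q, ⟨m, h3, h4⟩, rfl⟩

/-- Since steps lift as well as map forward, a word is defined at `f p` exactly when it is defined
at `p`. This invariance forces uniqueness of maps to the space of codes. -/
theorem code_eq (hf : F.Hom G f) (p : F.Pt) : G.code (f p) = F.code p := by
  funext L
  refine (code_eq_code (fun m hm => ⟨f m, hf.reach hm, (hf.cls m).symm⟩) fun m hm => ?_).symm
  obtain ⟨q, hq, -⟩ := hf.lift_reach hm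
  exact ⟨q, hq⟩

end Hom

end Flow

/-! ### Passing to the next layer of the multiresolution and back -/

variable {E : BipSepGraph.{u}}

theorem fill_self (x : E.Edge) (z : E.Z (E.grp x)) (X : E.C) (hX : E.base X = E.r x)
    (h : E.grp x = X) : (E.fill x z ⟨X, hX⟩).1 = x := by
  subst h
  simp [fill]

theorem fill_injective (x : E.Edge) : Function.Injective (E.fill x) := by
  intro z z' h
  funext Y
  have := congrFun h ⟨Y.1, Y.2.1⟩
  simpa [fill, Y.2.2] using this

theorem next_s_val {α : E.next.Edge} {u : E.V0} {t : ∀ X : E.Cat u, E.Blk X.1}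
    (h : E.next.s α = ⟨u, t⟩) (X : E.Cat u) (hX : E.grp α.1 = X.1) : (t X).1 = α.1 := by
  obtain ⟨x, z⟩ := α
  obtain ⟨X, hX'⟩ := X
  change (⟨E.r x, E.fill x z⟩ : Σ v : E.V0, ∀ X : E.Cat v, E.Blk X.1) = ⟨u, t⟩ at h
  obtain ⟨rfl, h⟩ := Sigma.mk.inj_iff.1 h
  obtain rfl := eq_of_heq h
  exact E.fill_self x z X hX' hX

theorem next_edge_ext {α β : E.next.Edge} (h : E.next.s α = E.next.s β) (h' : α.1 = β.1) :
    α = β := by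
  obtain ⟨x, z⟩ := α
  obtain ⟨y, z'⟩ := β
  dsimp only at h'
  subst h'
  have h := eq_of_heq (Sigma.mk.inj_iff.1 h).2
  exact congrArg (Sigma.mk x) (fill_injective _ h)

theorem exists_next_edge_of_eq {u : E.V0} (t : ∀ X : E.Cat u, E.Blk X.1) (x : E.Edge)
    (hu : E.r x = u) (ht : (t ⟨E.grp x, hu⟩).1 = x) :
    ∃ α : E.next.Edge, E.next.s α = ⟨u, t⟩ ∧ α.1 = x := by
  subst hu
  exact ⟨⟨x, fun Y => t ⟨Y.1, Y.2.1⟩⟩, Sigma.ext rfl (heq_of_eq (E.fill_eq x t ht)), rfl⟩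

theorem exists_next_edge {u : E.V0} (t : ∀ X : E.Cat u, E.Blk X.1) (X : E.Cat u) :
    ∃ α : E.next.Edge, E.next.s α = ⟨u, t⟩ ∧ α.1 = (t X).1 := by
  obtain ⟨X, rfl⟩ := X
  refine exists_next_edge_of_eq t _ (congrArg E.base (t ⟨X, rfl⟩).2) ?_
  exact congrArg (fun Y => (t Y).1) (Subtype.ext (t ⟨X, rfl⟩).2)

namespace Flow

theorem exists_cat (u : E.V0) : Nonempty (E.Cat u) :=
  let ⟨X, h⟩ := E.base_surj u
  ⟨⟨X, h⟩⟩

/-- The class of a point in the multiresolution of the separated graph. -/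
def UpCls (F : E.Flow) (p : F.Pt) : E.next.V0 ⊕ E.next.V1 → Prop
  | Sum.inl w => F.cls p = Sum.inr w
  | Sum.inr ⟨u, t⟩ => F.cls p = Sum.inl u ∧ ∀ X, ∃ p', F.R (t X).1 p' p

theorem existsUnique_upCls (F : E.Flow) (p : F.Pt) : ∃! v, F.UpCls p v := by
  rcases h : F.cls p with u | w
  · have key : ∀ X : E.Cat u, ∃ x : E.Blk X.1, ∃ p', F.R x.1 p' p := by
      rintro ⟨X, rfl⟩
      obtain ⟨x, p', hx, hp⟩ := F.exists_bwd h
      exact ⟨⟨x, hx⟩, p', hp⟩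
    choose t ht using key
    refine ⟨Sum.inr ⟨u, t⟩, ⟨h, ht⟩, ?_⟩
    rintro (w | ⟨u', t'⟩) hv
    · exact absurd (h.symm.trans hv) (by simp)
    · obtain ⟨h1, h2⟩ := hv
      obtain rfl := Sum.inl_injective (h1.symm.trans h)
      congr 2
      funext X
      obtain ⟨p1, h3⟩ := h2 X
      obtain ⟨p2, h4⟩ := ht X
      exact Subtype.ext (F.unique_bwd h3 h4 ((t' X).2.trans (t X).2.symm)).1
  · refine ⟨Sum.inl w, h, ?_⟩
    rintro (w' | ⟨u', t'⟩) hv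
    · exact congrArg Sum.inl (Sum.inr_injective (Eq.trans (Eq.symm hv) h))
    · exact absurd (h.symm.trans hv.1) (by simp)

/-- The class of a point in the multiresolution of the separated graph. -/
noncomputable def upCls (F : E.Flow) (p : F.Pt) : E.next.V0 ⊕ E.next.V1 :=
  (F.existsUnique_upCls p).choose

theorem upCls_eq (F : E.Flow) {p : F.Pt} {v : E.next.V0 ⊕ E.next.V1} :
    F.upCls p = v ↔ F.UpCls p v :=
  ⟨fun h => h ▸ (F.existsUnique_upCls p).choose_spec.1,
    fun h => ((F.existsUnique_upCls p).choose_spec.2 v h).symm⟩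

theorem upCls_eq_inl (F : E.Flow) {p : F.Pt} {w : E.V1} :
    F.upCls p = Sum.inl w ↔ F.cls p = Sum.inr w := F.upCls_eq

theorem upCls_eq_inr (F : E.Flow) {p : F.Pt} {u : E.V0} {t : ∀ X : E.Cat u, E.Blk X.1} :
    F.upCls p = Sum.inr ⟨u, t⟩ ↔ F.cls p = Sum.inl u ∧ ∀ X, ∃ p', F.R (t X).1 p' p := F.upCls_eq

theorem upCls_eq_s (F : E.Flow) {q : F.Pt} {α : E.next.Edge}
    (h : F.upCls q = Sum.inr (E.next.s α)) : ∃ p, F.R α.1 p q := by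
  obtain ⟨p, hp⟩ := (F.upCls_eq_inr.1 h).2 ⟨E.grp α.1, rfl⟩
  exact ⟨p, (E.fill_self α.1 α.2 _ _ rfl) ▸ hp⟩

theorem exists_upCls_eq_s (F : E.Flow) {x : E.Edge} {p q : F.Pt} (h : F.R x p q) :
    ∃ α : E.next.Edge, α.1 = x ∧ F.upCls q = Sum.inr (E.next.s α) := by
  rcases e : F.upCls q with w | ⟨u, t⟩
  · exact absurd ((F.upCls_eq_inl.1 e).symm.trans (F.cls_right h)) (by simp)
  · have h1 := F.upCls_eq_inr.1 e
    have hu : E.r x = u := Sum.inl_injective ((F.cls_right h).symm.trans h1.1)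
    obtain ⟨p', h2⟩ := h1.2 ⟨E.grp x, hu⟩
    have h3 := (F.unique_bwd h2 h (t _).2).1
    obtain ⟨α, h4, h5⟩ := exists_next_edge_of_eq t x hu h3
    exact ⟨α, h5, by rw [h4]⟩

/-- An `(E, C)`-dynamical system as an `(E_1, C^1)`-dynamical system. -/
noncomputable def up (F : E.Flow) : E.next.Flow where
  Pt := F.Pt
  cls := F.upCls
  -- The pair is reversed because the map of α^x restricts θ_x⁻¹; the class of `q` fixes the
  -- remaining entries of the tuple.
  R α q p := F.R α.1 p q ∧ F.upCls q = Sum.inr (E.next.s α)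
  cls_left h := h.2
  cls_right h := F.upCls_eq_inl.2 (F.cls_left h.1)
  exists_fwd h := (F.upCls_eq_s h).imp fun _ hp => ⟨hp, h⟩
  unique_fwd h h' := (F.unique_bwd h.1 h'.1 rfl).2
  exists_bwd {x p} h := by
    obtain ⟨q, hq⟩ := F.exists_fwd (F.upCls_eq_inl.1 h)
    obtain ⟨α, rfl, h'⟩ := F.exists_upCls_eq_s hq
    exact ⟨α, q, rfl, hq, h'⟩
  unique_bwd {α α' q q' p} h h' e := by
    change α.1 = α'.1 at e
    obtain ⟨h1, h2⟩ := h
    obtain ⟨h3, h4⟩ := h'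
    rw [e] at h1
    obtain rfl := F.unique_fwd h1 h3
    exact ⟨next_edge_ext (Sum.inr_injective (h2.symm.trans h4)) e, rfl⟩

/-- The class in E_1 of a point over E^{0,0} lists the edges arriving there. The class after a
single letter depends only on the letter, so words of length one contribute only whether they are
defined. -/
theorem agree_one {F : E.Flow} {p q : F.Pt} : F.Agree 1 p q ↔ F.upCls p = F.upCls q := by
  constructor
  · intro h
    obtain ⟨h0, h1⟩ := agree_succ.1 h
    refine F.upCls_eq.2 ?_
    rcases e : F.upCls q with w | ⟨u, t⟩
    · exact h0.trans (F.upCls_eq_inl.1 e)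
    · have := F.upCls_eq_inr.1 e
      exact ⟨h0.trans this.1, fun X => (h1 ((t X).1, false)).1.2 (this.2 X)⟩
  · intro h
    have h0 : F.cls p = F.cls q ∧ ∀ x, (∃ p', F.R x p' p) → ∃ q', F.R x q' q := by
      rcases e : F.upCls p with w | ⟨u, t⟩
      · have e' := F.upCls_eq_inl.1 e
        refine ⟨e'.trans (F.upCls_eq_inl.1 (h.symm.trans e)).symm, fun x ⟨p', hp⟩ => ?_⟩
        exact absurd (e'.symm.trans (F.cls_right hp)) (by simp)
      · have e' := F.upCls_eq_inr.1 (h.symm.trans e)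
        refine ⟨(F.upCls_eq_inr.1 e).1.trans e'.1.symm, fun x ⟨p', hp⟩ => ?_⟩
        obtain ⟨α, rfl, h2⟩ := F.exists_upCls_eq_s hp
        exact F.upCls_eq_s (h.symm.trans h2)
    have h0' : ∀ x, (∃ p', F.R x p' q) → ∃ q', F.R x q' p := by
      rintro x ⟨p', hp⟩
      obtain ⟨α, rfl, h2⟩ := F.exists_upCls_eq_s hp
      exact F.upCls_eq_s (h.trans h2)
    refine agree_succ.2 ⟨h0.1, ?_⟩
    rintro ⟨x, _ | _⟩
    · exact ⟨⟨h0.2 x, h0' x⟩, fun p' q' hp hq => agree_zero.2 (hp.cls_eq hq)⟩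
    · exact ⟨⟨fun ⟨p', hp⟩ => F.exists_fwd (h0.1 ▸ F.cls_left hp),
        fun ⟨p', hp⟩ => F.exists_fwd (h0.1.symm ▸ F.cls_left hp)⟩,
        fun p' q' hp hq => agree_zero.2 (hp.cls_eq hq)⟩

/-- A letter of E_1 is a letter of E in the opposite direction, together with a condition on the
E_1-class of its endpoint over E^{0,0}. That condition is visible to words of length one, which
accounts for the shift. -/
theorem agree_up {F : E.Flow} {n : ℕ} {p q : F.Pt} :
    F.up.Agree n p q ↔ F.Agree (n + 1) p q := by
  induction n generalizing p q with
  | zero => exact agree_zero.trans agree_one.symm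
  | succ n ih =>
    refine Iff.trans agree_succ (Iff.trans ?_ agree_succ.symm)
    constructor
    · rintro ⟨h0, h1⟩
      have h2 := agree_one.2 h0
      refine ⟨h2.cls_eq, fun a => ⟨(agree_succ.1 h2).2 a |>.1, ?_⟩⟩
      obtain ⟨x, _ | _⟩ := a
      · intro b b' hb hb'
        obtain ⟨α, rfl, h3⟩ := F.exists_upCls_eq_s hb
        exact ih.1 ((h1 (α, true)).2 b b' ⟨hb, h3⟩ ⟨hb', h0.symm.trans h3⟩)
      · intro b b' hb hb'
        obtain ⟨α, rfl, h3⟩ := F.exists_upCls_eq_s hb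
        obtain ⟨b'', h4, h5⟩ := (h1 (α, false)).1.1 ⟨b, hb, h3⟩
        obtain rfl := F.unique_fwd h4 hb'
        exact ih.1 ((h1 (α, false)).2 b _ ⟨hb, h3⟩ ⟨h4, h5⟩)
    · intro H
      have h2 : F.Agree 1 p q := Agree.mono (Nat.le_add_left 1 (n + 1)) (agree_succ.2 H)
      have h0 := agree_one.1 h2
      obtain ⟨-, h1⟩ := H
      -- Whether α ends at a given point depends on the E_1-class of the point `b` on the other
      -- side; agreement of `b` and `b'` up to length one transfers it.
      have aux : ∀ {α : E.next.Edge} {p q : F.Pt}, F.Agree 1 p q →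
          (∀ b b', F.R α.1 p b → F.R α.1 q b' → F.Agree (n + 1) b b') →
          (∃ b, F.R α.1 p b ∧ F.upCls b = Sum.inr (E.next.s α)) →
          ∃ b, F.R α.1 q b ∧ F.upCls b = Sum.inr (E.next.s α) := by
        rintro α p q h h' ⟨b, h3, h4⟩
        obtain ⟨b', h5⟩ := F.exists_fwd (h.cls_eq ▸ F.cls_left h3)
        exact ⟨b', h5, (agree_one.1 ((h' b b' h3 h5).mono (Nat.le_add_left 1 n))).symm.trans h4⟩
      refine ⟨h0, ?_⟩
      rintro ⟨α, _ | _⟩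
      · refine ⟨⟨aux h2 (h1 (α.1, true)).2, aux h2.symm fun b b' hb hb' => ?_⟩,
          fun b b' hb hb' => ih.2 ((h1 (α.1, true)).2 b b' hb.1 hb'.1)⟩
        exact ((h1 (α.1, true)).2 b' b hb' hb).symm
      · refine ⟨⟨fun ⟨b, hb⟩ => ?_, fun ⟨b, hb⟩ => ?_⟩,
          fun b b' hb hb' => ih.2 ((h1 (α.1, false)).2 b b' hb.1 hb'.1)⟩
        · exact F.up.exists_fwd (Eq.trans (Eq.symm h0) hb.2)
        · exact F.up.exists_fwd (Eq.trans h0 hb.2)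

theorem Hom.up {F G : E.Flow} {f : F.Pt → G.Pt} (hf : F.Hom G f) : F.up.Hom G.up f := by
  have h : ∀ p, G.upCls (f p) = F.upCls p := by
    refine fun p => G.upCls_eq.2 ?_
    rcases e : F.upCls p with w | ⟨u, t⟩
    · exact (hf.cls p).trans (F.upCls_eq_inl.1 e)
    · obtain ⟨h1, h2⟩ := F.upCls_eq_inr.1 e
      exact ⟨(hf.cls p).trans h1, fun X => (h2 X).elim fun p' hp => ⟨f p', hf.R hp⟩⟩
  exact ⟨h, fun hR => ⟨hf.R hR.1, (h _).trans hR.2⟩⟩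

/-- The class in `E⁰` belonging to a class in `E_1⁰`. -/
def downCls : E.next.V0 ⊕ E.next.V1 → E.V0 ⊕ E.V1
  | Sum.inl w => Sum.inr w
  | Sum.inr v => Sum.inl v.1

theorem downCls_eq_inr {v : E.next.V0 ⊕ E.next.V1} {w : E.V1} :
    downCls v = Sum.inr w ↔ v = Sum.inl w := by
  rcases v with v | v
  · exact ⟨fun h => congrArg Sum.inl (Sum.inr_injective h),
      fun h => congrArg Sum.inr (Sum.inl_injective h)⟩
  · simp [downCls]

/-- An `(E_1, C^1)`-dynamical system as an `(E, C)`-dynamical system. -/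
def down (G : E.next.Flow) : E.Flow where
  Pt := G.Pt
  cls p := downCls (G.cls p)
  R x p q := ∃ α : E.next.Edge, α.1 = x ∧ G.R α q p
  cls_left := by
    rintro x p q ⟨α, rfl, h⟩
    exact downCls_eq_inr.2 (G.cls_right h)
  cls_right := by
    rintro x p q ⟨α, rfl, h⟩
    rw [G.cls_left h]
    rfl
  exists_fwd {x p} h := by
    obtain ⟨α, q, rfl, hq⟩ := G.exists_bwd (X := x) (downCls_eq_inr.1 h)
    exact ⟨q, α, rfl, hq⟩
  unique_fwd := by
    rintro x p q q' ⟨α, rfl, h⟩ ⟨β, e, h'⟩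
    exact (G.unique_bwd h h' e.symm).2
  exists_bwd {X q} h := by
    rcases e : G.cls q with w | ⟨u, t⟩
    · rw [e] at h
      exact absurd h (by simp [downCls])
    · rw [e] at h
      obtain rfl : u = E.base X := Sum.inl_injective h
      obtain ⟨α, h1, h2⟩ := exists_next_edge t ⟨X, rfl⟩
      obtain ⟨p, hp⟩ := G.exists_fwd (e.trans (congrArg Sum.inr h1.symm))
      exact ⟨α.1, p, h2 ▸ (t ⟨X, rfl⟩).2, α, rfl, hp⟩
  unique_bwd := by
    rintro x x' p p' q ⟨α, rfl, h⟩ ⟨β, rfl, h'⟩ e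
    -- Both arrows start at the class of `q`, and its tuple has only one entry in the common block.
    have h1 : E.next.s α = E.next.s β :=
      Sum.inr_injective ((G.cls_left h).symm.trans (G.cls_left h'))
    have h2 : α.1 = β.1 :=
      ((next_s_val rfl ⟨E.grp α.1, rfl⟩ rfl).symm.trans (next_s_val h1.symm _ e.symm))
    obtain rfl := next_edge_ext h1 h2
    exact ⟨rfl, G.unique_fwd h h'⟩

theorem hom_up_down (G : E.next.Flow) : G.Hom G.down.up id := by
  have h : ∀ p, G.down.upCls p = G.cls p := by
    refine fun p => G.down.upCls_eq.2 ?_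
    rcases e : G.cls p with w | ⟨u, t⟩
    · exact downCls_eq_inr.2 e
    · refine ⟨congrArg downCls e, fun X => ?_⟩
      obtain ⟨α, h1, h2⟩ := exists_next_edge t X
      obtain ⟨p', hp⟩ := G.exists_fwd (e.trans (congrArg Sum.inr h1.symm))
      exact ⟨p', α, h2, hp⟩
  exact ⟨h, fun hR => ⟨⟨_, rfl, hR⟩, (h _).trans (G.cls_left hR)⟩⟩

/-- An `(E, C)`-dynamical system as an `(E_n, C^n)`-dynamical system. -/
noncomputable def iter (F : E.Flow) : (n : ℕ) → (E.seq n).Flow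
  | 0 => F
  | n + 1 => (F.iter n).up

/-- The point of `F` as a point of `F.iter n`. -/
def toIter (F : E.Flow) : (n : ℕ) → F.Pt → (F.iter n).Pt
  | 0, p => p
  | n + 1, p => F.toIter n p

theorem toIter_surjective (F : E.Flow) (n : ℕ) : Function.Surjective (F.toIter n) := by
  induction n with
  | zero => exact Function.surjective_id
  | succ n ih => exact ih

theorem agree_iter (F : E.Flow) (n m : ℕ) {p q : F.Pt} :
    (F.iter n).Agree m (F.toIter n p) (F.toIter n q) ↔ F.Agree (m + n) p q := by
  induction n generalizing m with
  | zero => rfl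
  | succ n ih => exact agree_up.trans ((ih (m + 1)).trans (by rw [Nat.add_right_comm]; rfl))

/-- Each layer contributes one letter, starting from agreement on the empty word. -/
theorem cls_iter_eq_iff (F : E.Flow) (n : ℕ) {p q : F.Pt} :
    (F.iter n).cls (F.toIter n p) = (F.iter n).cls (F.toIter n q) ↔ F.Agree n p q := by
  rw [← agree_zero, agree_iter, Nat.zero_add]

theorem Hom.iter {F G : E.Flow} {f : F.Pt → G.Pt} (hf : F.Hom G f) (n : ℕ) :
    ∃ g, (F.iter n).Hom (G.iter n) g := by
  induction n with
  | zero => exact ⟨f, hf⟩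
  | succ n ih => exact ih.imp fun _ hg => hg.up

/-- Descends one layer at a time with `down`. It transfers the existence of points of a given class
from E_n to E. -/
theorem exists_hom_iter (n : ℕ) (G : (E.seq n).Flow) :
    ∃ F : E.Flow, ∃ g, G.Hom (F.iter n) g := by
  induction n with
  | zero => exact ⟨G, id, fun _ => rfl, id⟩
  | succ n ih =>
    obtain ⟨F, g, hg⟩ := ih G.down
    exact ⟨F, g, hg.up.comp G.hom_up_down⟩

end Flow

/-! ### A flow in which every class occurs -/

theorem finite_next [Finite E.Edge] : Finite E.next.Edge := by
  have : Finite E.C := Finite.of_surjective _ E.grp_surj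
  exact inferInstanceAs (Finite (Σ x : E.Edge, E.Z (E.grp x)))

theorem finite_seq [Finite E.Edge] (n : ℕ) : Finite (E.seq n).Edge := by
  induction n with
  | zero => assumption
  | succ n ih => exact finite_next

/-- Every finite bipartite separated graph has a flow in which all classes occur. -/
theorem Flow.exists_cls_surjective (E : BipSepGraph.{u}) [Finite E.Edge] :
    ∃ F : E.Flow, Function.Surjective F.cls := by
  -- Place a copy of ℕ over each vertex. A block is finite and nonempty, so the copies at the
  -- sources of its edges, one for each edge, together fill exactly one copy of ℕ at its base.
  have key : ∀ X : E.C, Nonempty (E.Blk X × ℕ ≃ ℕ) := fun X => by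
    obtain ⟨x, hx⟩ := E.grp_surj X
    have : Nonempty (E.Blk X) := ⟨⟨x, hx⟩⟩
    exact nonempty_equiv_of_countable
  have e := fun X => (key X).some
  refine ⟨{
    Pt := (E.V0 ⊕ E.V1) × ℕ
    cls := Prod.fst
    R x p q := p.1 = Sum.inr (E.s x) ∧ q.1 = Sum.inl (E.r x) ∧ e (E.grp x) (⟨x, rfl⟩, p.2) = q.2
    cls_left h := h.1
    cls_right h := h.2.1
    exists_fwd h := ⟨⟨_, _⟩, h, rfl, rfl⟩
    unique_fwd h h' := Prod.ext (h.2.1.trans h'.2.1.symm) (h.2.2.symm.trans h'.2.2)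
    exists_bwd := ?_
    unique_bwd := ?_ }, fun v => ⟨(v, 0), rfl⟩⟩
  · intro X q h
    obtain ⟨⟨⟨x, rfl⟩, n⟩, hx⟩ := (e X).surjective q.2
    exact ⟨x, (_, n), rfl, rfl, h, hx⟩
  · rintro x x' ⟨v, n⟩ ⟨v', n'⟩ q h h' hx
    have key : ∀ X (h1 : E.grp x = X) (h2 : E.grp x' = X), e X (⟨x, h1⟩, n) = q.2 →
        e X (⟨x', h2⟩, n') = q.2 → x = x' ∧ n = n' := by
      intro X h1 h2 h3 h4
      simpa using (e X).injective (h3.trans h4.symm)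
    obtain ⟨rfl, rfl⟩ := key (E.grp x') hx rfl
      (by
        have : ∀ X (h1 : E.grp x = X), e X (⟨x, h1⟩, n) = q.2 := by
          rintro X rfl
          exact h.2.2
        exact this _ hx) h'.2.2
    exact ⟨rfl, Prod.ext (h.1.trans h'.1.symm) rfl⟩

/-! ### The flow of a dynamical system and the sets of the layers -/

namespace DynSystem

/-- The flow underlying a dynamical system. -/
noncomputable def flow (S : E.DynSystem) : E.Flow where
  Pt := S.Pt
  cls p := (S.Ω_cover p).choose
  R x p q := p ∈ S.Ω (Sum.inr (E.s x)) ∧ S.θ x p = q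
  cls_left {x p q} h := ((S.Ω_cover p).choose_spec.2 _ h.1).symm
  cls_right {x p q} h := by
    refine ((S.Ω_cover q).choose_spec.2 _ ?_).symm
    have : q ∈ (S.θ x).target := h.2 ▸ (S.θ x).map_source (S.source_θ x ▸ h.1)
    exact (S.iUnion_target (E.grp x)).subset (Set.mem_iUnion_of_mem ⟨x, rfl⟩ this)
  exists_fwd {x p} h := ⟨_, h ▸ (S.Ω_cover p).choose_spec.1, rfl⟩
  unique_fwd h h' := h.2.symm.trans h'.2
  exists_bwd {X q} h := by
    have : q ∈ S.Ω (Sum.inl (E.base X)) := h ▸ (S.Ω_cover q).choose_spec.1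
    rw [← S.iUnion_target, Set.mem_iUnion] at this
    obtain ⟨⟨x, hx⟩, hq⟩ := this
    exact ⟨x, (S.θ x).symm q, hx, S.source_θ x ▸ (S.θ x).map_target hq, (S.θ x).right_inv hq⟩
  unique_bwd {x x' p p' q} h h' e := by
    have h1 : p ∈ (S.θ x).source := S.source_θ x ▸ h.1
    have h2 : p' ∈ (S.θ x').source := S.source_θ x' ▸ h'.1
    obtain rfl : x = x' := by
      by_contra hne
      exact Set.disjoint_left.1 (S.disjoint_target x x' e hne)
        (h.2 ▸ (S.θ x).map_source h1) (h'.2 ▸ (S.θ x').map_source h2)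
    exact ⟨rfl, (S.θ x).injOn h1 h2 (h.2.trans h'.2.symm)⟩

theorem flow_cls_eq (S : E.DynSystem) {p : S.Pt} {v : E.V0 ⊕ E.V1} :
    S.flow.cls p = v ↔ p ∈ S.Ω v :=
  ⟨fun h => h ▸ (S.Ω_cover p).choose_spec.1,
    fun h => ((S.Ω_cover p).choose_spec.2 v h).symm⟩

theorem flow_R (S : E.DynSystem) {x : E.Edge} {p q : S.Pt} :
    S.flow.R x p q ↔ p ∈ (S.θ x).source ∧ S.θ x p = q := by
  rw [S.source_θ]
  rfl

theorem mem_H_iff (S : E.DynSystem) {x : E.Edge} {q : S.Pt} :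
    q ∈ S.H x ↔ ∃ p, S.flow.R x p q := by
  constructor
  · exact fun h => ⟨(S.θ x).symm q, S.flow_R.2 ⟨(S.θ x).map_target h, (S.θ x).right_inv h⟩⟩
  · rintro ⟨p, hp⟩
    obtain ⟨h1, h2⟩ := S.flow_R.1 hp
    exact h2 ▸ (S.θ x).map_source h1

theorem reach_iff (S : E.DynSystem) {L : List (E.Edge × Bool)} {p q : S.Pt} :
    S.flow.Reach L p q ↔ p ∈ (S.wordAction L).source ∧ S.wordAction L p = q := by
  induction L generalizing q with
  | nil => exact ⟨fun h => ⟨trivial, h⟩, fun h => h.2⟩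
  | cons a L ih =>
    obtain ⟨x, _ | _⟩ := a
    · simp only [Flow.Reach, Flow.Step, wordAction, PartialEquiv.trans_source, Set.mem_inter_iff,
        Set.mem_preimage, PartialEquiv.coe_trans, Function.comp]
      constructor
      · rintro ⟨m, h0, h2⟩
        obtain ⟨h1, rfl⟩ := ih.1 h0
        obtain ⟨h3, h4⟩ := S.flow_R.1 h2
        exact ⟨⟨h1, h4 ▸ (S.θ x).map_source h3⟩, h4 ▸ (S.θ x).left_inv h3⟩
      · rintro ⟨⟨h1, h2⟩, rfl⟩
        exact ⟨_, ih.2 ⟨h1, rfl⟩, S.flow_R.2 ⟨(S.θ x).map_target h2, (S.θ x).right_inv h2⟩⟩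
    · simp only [Flow.Reach, Flow.Step, wordAction, PartialEquiv.trans_source, Set.mem_inter_iff,
        Set.mem_preimage, PartialEquiv.coe_trans, Function.comp]
      constructor
      · rintro ⟨m, h0, h2⟩
        obtain ⟨h1, rfl⟩ := ih.1 h0
        obtain ⟨h3, h4⟩ := S.flow_R.1 h2
        exact ⟨⟨h1, h3⟩, h4⟩
      · rintro ⟨⟨h1, h2⟩, h3⟩
        exact ⟨_, ih.2 ⟨h1, rfl⟩, S.flow_R.2 ⟨h2, h3⟩⟩

theorem mem_target_iff_of_graph {α : Type*} (e : PartialEquiv α α) {R : α → α → Prop}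
    (h : ∀ p q, (p ∈ e.source ∧ e p = q) ↔ R p q) (q : α) : q ∈ e.target ↔ ∃ p, R p q := by
  constructor
  · exact fun hq => ⟨e.symm q, (h _ _).1 ⟨e.map_target hq, e.right_inv hq⟩⟩
  · rintro ⟨p, hp⟩
    obtain ⟨h1, h2⟩ := (h _ _).2 hp
    exact h2 ▸ e.map_source h1

/-- The description of the edge maps is a hypothesis so that this can serve inside the induction
proving that description. -/
theorem mem_iInter_target_iff (S : E.DynSystem) {n : ℕ}
    (h : ∀ (x : (E.seq n).Edge) (p q : S.Pt), (p ∈ (S.edgeMap n x).source ∧ S.edgeMap n x p = q) ↔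
      (S.flow.iter n).R x (S.flow.toIter n p) (S.flow.toIter n q))
    {u : (E.seq n).V0} (t : ∀ X : (E.seq n).Cat u, (E.seq n).Blk X.1) (p : S.Pt) :
    p ∈ ⋂ X, (S.edgeMap n (t X).1).target ↔
      (S.flow.iter (n + 1)).cls (S.flow.toIter (n + 1) p) = Sum.inr ⟨u, t⟩ := by
  have key : ∀ x, p ∈ (S.edgeMap n x).target ↔
      ∃ p', (S.flow.iter n).R x p' (S.flow.toIter n p) := fun x =>
    (mem_target_iff_of_graph _ (h x) p).trans ((S.flow.toIter_surjective n).exists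
      (p := fun p' => (S.flow.iter n).R x p' (S.flow.toIter n p))).symm
  refine Iff.trans ?_ (S.flow.iter n).upCls_eq_inr.symm
  simp only [Set.mem_iInter, key]
  refine ⟨fun H => ⟨?_, H⟩, fun H => H.2⟩
  -- The blocks at `u` are not an empty family, so some arriving edge places the point over `u`.
  obtain ⟨X⟩ := Flow.exists_cat u
  obtain ⟨p', hp⟩ := H X
  exact ((S.flow.iter n).cls_right hp).trans
    (congrArg Sum.inl ((congrArg (E.seq n).base (t X).2).trans X.2))

theorem edgeMap_graph (S : E.DynSystem) (n : ℕ) (x : (E.seq n).Edge) (p q : S.Pt) :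
    (p ∈ (S.edgeMap n x).source ∧ S.edgeMap n x p = q) ↔
      (S.flow.iter n).R x (S.flow.toIter n p) (S.flow.toIter n q) := by
  induction n generalizing p q with
  | zero => exact S.flow_R.symm
  | succ n ih =>
    have h := S.mem_iInter_target_iff (u := (E.seq n).r x.1) ih ((E.seq n).fill x.1 x.2) p
    have h' := ih x.1 q p
    change (p ∈ (S.edgeMap n x.1).target ∩ (⋂ X, (S.edgeMap n ((E.seq n).fill x.1 x.2 X).1).target) ∧
      (S.edgeMap n x.1).symm p = q) ↔ ((S.flow.iter n).R x.1 _ _ ∧ _)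
    refine Iff.trans ?_ (and_congr h' h)
    constructor
    · rintro ⟨⟨h1, h2⟩, rfl⟩
      exact ⟨⟨(S.edgeMap n x.1).map_target h1, (S.edgeMap n x.1).right_inv h1⟩, h2⟩
    · rintro ⟨⟨h1, rfl⟩, h2⟩
      exact ⟨⟨(S.edgeMap n x.1).map_source h1, h2⟩, (S.edgeMap n x.1).left_inv h1⟩

theorem mem_layerSet_iff (S : E.DynSystem) (n : ℕ) (v : E.D n) (p : S.Pt) :
    p ∈ S.layerSet n v ↔ (S.flow.iter n).cls (S.flow.toIter n p) = Sum.inl v := by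
  obtain _ | _ | n := n
  · exact S.flow_cls_eq.symm
  · exact S.flow_cls_eq.symm.trans S.flow.upCls_eq_inl.symm
  · exact (S.mem_iInter_target_iff (S.edgeMap_graph n) v.2 p).trans
      (S.flow.iter (n + 1)).upCls_eq_inl.symm

/-- Two unfoldings of the class lead from a vertex of D_{2m+3} to its parent in D_{2m+1}, which is
one step of the root map. -/
theorem cls_eq_root (S : E.DynSystem) (m : ℕ) (v : E.D (2 * m + 1)) (p : S.Pt)
    (h : (S.flow.iter (2 * m + 1)).cls (S.flow.toIter (2 * m + 1) p) = Sum.inl v) :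
    S.flow.cls p = Sum.inr (E.root m v) := by
  induction m with
  | zero => exact S.flow.upCls_eq_inl.1 h
  | succ m ih =>
    have h1 := (S.flow.iter (2 * m + 2)).upCls_eq_inl.1 h
    exact ih (E.parent (2 * m + 1) v) ((S.flow.iter (2 * m + 1)).upCls_eq_inr.1 h1).1

theorem exists_cls_iter_eq_inl (S : E.DynSystem) {m : ℕ} {p : S.Pt} {w : E.V1}
    (h : S.flow.cls p = Sum.inr w) : ∃ v : E.D (2 * m + 1), E.root m v = w ∧
      (S.flow.iter (2 * m + 1)).cls (S.flow.toIter (2 * m + 1) p) = Sum.inl v := by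
  suffices H : ∃ v : E.D (2 * m + 1),
      (S.flow.iter (2 * m + 1)).cls (S.flow.toIter (2 * m + 1) p) = Sum.inl v by
    obtain ⟨v, hv⟩ := H
    exact ⟨v, Sum.inr_injective ((S.cls_eq_root m v p hv).symm.trans h), hv⟩
  induction m with
  | zero => exact ⟨w, S.flow.upCls_eq_inl.2 h⟩
  | succ m ih =>
    obtain ⟨v, hv⟩ := ih
    rcases e : (S.flow.iter (2 * m + 2)).cls (S.flow.toIter (2 * m + 2) p) with v' | v'
    · exact absurd (((S.flow.iter (2 * m + 1)).upCls_eq_inl.1 e).symm.trans hv) (by simp)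
    · exact ⟨v', (S.flow.iter (2 * m + 2)).upCls_eq_inl.2 e⟩

end DynSystem

/-! ### Axioms for codes -/

/-- The class of the points in the image of `θ_a`, for a letter `a`. -/
def letterCod (E : BipSepGraph.{u}) : E.Edge × Bool → E.V0 ⊕ E.V1
  | (x, true) => Sum.inl (E.r x)
  | (x, false) => Sum.inr (E.s x)

/-- The inverse of a letter. -/
def letterInv (a : E.Edge × Bool) : E.Edge × Bool := (a.1, !a.2)

namespace Flow

theorem Step.cls_target {F : E.Flow} {a : E.Edge × Bool} {p q : F.Pt} (h : F.Step a p q) :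
    F.cls q = E.letterCod a := by
  obtain ⟨x, _ | _⟩ := a
  · exact F.cls_left h
  · exact F.cls_right h

theorem Step.inv {F : E.Flow} {a : E.Edge × Bool} {p q : F.Pt} (h : F.Step a p q) :
    F.Step (letterInv a) q p := by
  obtain ⟨x, _ | _⟩ := a <;> exact h

theorem reach_append {F : E.Flow} {L M : List (E.Edge × Bool)}
    {p q : F.Pt} : F.Reach (M ++ L) p q ↔ ∃ m, F.Reach L p m ∧ F.Reach M m q := by
  induction M generalizing q with
  | nil => simp [Reach]
  | cons b M ih =>
    simp only [List.cons_append, Reach, ih]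
    constructor
    · rintro ⟨m, ⟨m', h1, h2⟩, h3⟩
      exact ⟨m', h1, m, h2, h3⟩
    · rintro ⟨m', h1, m, h2, h3⟩
      exact ⟨m, ⟨m', h1, h2⟩, h3⟩

end Flow

/-- The functions on words that are codes of points. -/
structure IsCode (E : BipSepGraph.{u}) (c : List (E.Edge × Bool) → Option (E.V0 ⊕ E.V1)) :
    Prop where
  nil : c [] ≠ none
  cons : ∀ a L, c (a :: L) ≠ none →
    c L = some (E.letterCod (letterInv a)) ∧ c (a :: L) = some (E.letterCod a)
  fwd : ∀ x L, c L = some (Sum.inr (E.s x)) → c ((x, true) :: L) ≠ none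
  bwd : ∀ X L, c L = some (Sum.inl (E.base X)) → ∃ x, E.grp x = X ∧ c ((x, false) :: L) ≠ none
  bwd_unique : ∀ x x' L, E.grp x = E.grp x' → c ((x, false) :: L) ≠ none →
    c ((x', false) :: L) ≠ none → x = x'
  cancel : ∀ a L M, c (a :: L) ≠ none → c (M ++ letterInv a :: a :: L) = c (M ++ L)

theorem Flow.isCode_code (F : E.Flow) (p : F.Pt) : E.IsCode (F.code p) where
  nil := by simp
  cons a L h := by
    obtain ⟨q, m, hm, hq⟩ := code_ne_none.1 h
    exact ⟨by rw [hm.code, hq.inv.cls_target],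
      by rw [Reach.code (L := a :: L) ⟨m, hm, hq⟩, hq.cls_target]⟩
  fwd x L h := by
    obtain ⟨q, hq, e⟩ := code_eq_some.1 h
    obtain ⟨m, hm⟩ := F.exists_fwd e
    exact code_ne_none.2 ⟨m, q, hq, hm⟩
  bwd X L h := by
    obtain ⟨q, hq, e⟩ := code_eq_some.1 h
    obtain ⟨x, m, hx, hm⟩ := F.exists_bwd e
    exact ⟨x, hx, code_ne_none.2 ⟨m, q, hq, hm⟩⟩
  bwd_unique x x' L h h1 h2 := by
    obtain ⟨q, m, hm, hq⟩ := code_ne_none.1 h1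
    obtain ⟨q', m', hm', hq'⟩ := code_ne_none.1 h2
    obtain rfl := hm.unique hm'
    exact (F.unique_bwd hq hq' h).1
  cancel a L M h := by
    obtain ⟨q, m, hm, hq⟩ := code_ne_none.1 h
    have h0 : F.Reach (letterInv a :: a :: L) p m := ⟨q, ⟨m, hm, hq⟩, hq.inv⟩
    refine code_eq_code (fun k hk => ⟨k, ?_, rfl⟩) fun k hk => ⟨k, ?_⟩
    · obtain ⟨m', h1, h2⟩ := reach_append.1 hk
      obtain rfl := h0.unique h1
      exact reach_append.2 ⟨m, hm, h2⟩
    · obtain ⟨m', h1, h2⟩ := reach_append.1 hk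
      obtain rfl := hm.unique h1
      exact reach_append.2 ⟨m, h0, h2⟩

namespace IsCode

variable {c : List (E.Edge × Bool) → Option (E.V0 ⊕ E.V1)}

theorem append_eq_none (hc : E.IsCode c) {L : List (E.Edge × Bool)} (h : c L = none)
    (M : List (E.Edge × Bool)) : c (M ++ L) = none := by
  induction M with
  | nil => exact h
  | cons a M ih =>
    by_contra h'
    exact absurd (ih.symm.trans (hc.cons a _ h').1) (by simp)

theorem shift (hc : E.IsCode c) {a : E.Edge × Bool} (h : c [a] ≠ none) :
    E.IsCode fun L => c (L ++ [a]) where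
  nil := h
  cons b L := hc.cons b (L ++ [a])
  fwd x L := hc.fwd x (L ++ [a])
  bwd X L := hc.bwd X (L ++ [a])
  bwd_unique x x' L := hc.bwd_unique x x' (L ++ [a])
  cancel b L M h := by simpa using hc.cancel b (L ++ [a]) M h

end IsCode

/-! ### The compact system of codes -/

/-- The space of codes. -/
abbrev CodeSpace (E : BipSepGraph.{u}) : Type u :=
  {c : List (E.Edge × Bool) → Option (E.V0 ⊕ E.V1) // E.IsCode c}

namespace CodeSpace

open scoped Classical in
/-- The action of a letter on codes. -/
noncomputable def step (a : E.Edge × Bool) (c : E.CodeSpace) : E.CodeSpace :=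
  -- Outside the domain of the letter the value is a dummy.
  if h : c.1 [a] ≠ none then ⟨_, c.2.shift h⟩ else c

theorem step_apply {a : E.Edge × Bool} {c : E.CodeSpace} (h : c.1 [a] ≠ none)
    (L : List (E.Edge × Bool)) : (step a c).1 L = c.1 (L ++ [a]) := by
  rw [step, dif_pos h]

theorem step_inv_ne_none {a : E.Edge × Bool} {c : E.CodeSpace} (h : c.1 [a] ≠ none) :
    (step a c).1 [letterInv a] ≠ none := by
  rw [step_apply h]
  exact (c.2.cancel a [] [] h).trans_ne c.2.nil

theorem step_inv_step {a : E.Edge × Bool} {c : E.CodeSpace} (h : c.1 [a] ≠ none) :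
    step (letterInv a) (step a c) = c := by
  refine Subtype.ext (funext fun L => ?_)
  rw [step_apply (step_inv_ne_none h), step_apply h]
  simpa using c.2.cancel a [] L h

/-- The discrete topology on the set of classes, with an added point. -/
local instance : TopologicalSpace (Option (E.V0 ⊕ E.V1)) := ⊥

local instance : DiscreteTopology (Option (E.V0 ⊕ E.V1)) := ⟨rfl⟩

theorem isClosed_setOf {ι : Type*} [Finite ι] (f : ι → List (E.Edge × Bool))
    (P : (ι → Option (E.V0 ⊕ E.V1)) → Prop) :
    IsClosed {c : List (E.Edge × Bool) → Option (E.V0 ⊕ E.V1) | P fun i => c (f i)} :=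
  (isClosed_discrete {x | P x}).preimage (by fun_prop)

/-- Each axiom, for fixed letters and words, restricts finitely many coordinates. Finiteness of the
edge set enters in `bwd`, which quantifies over all edges of a block. -/
theorem isClosed_isCode [Finite E.Edge] : IsClosed {c | E.IsCode c} := by
  have h : {c | E.IsCode c} = {c | c [] ≠ none} ∩
      (⋂ a, ⋂ L, {c | c (a :: L) ≠ none →
        c L = some (E.letterCod (letterInv a)) ∧ c (a :: L) = some (E.letterCod a)}) ∩
      (⋂ x, ⋂ L, {c | c L = some (Sum.inr (E.s x)) → c ((x, true) :: L) ≠ none}) ∩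
      (⋂ X, ⋂ L, {c | c L = some (Sum.inl (E.base X)) →
        ∃ x, E.grp x = X ∧ c ((x, false) :: L) ≠ none}) ∩
      (⋂ x, ⋂ x', ⋂ L, {c | E.grp x = E.grp x' → c ((x, false) :: L) ≠ none →
        c ((x', false) :: L) ≠ none → x = x'}) ∩
      (⋂ a, ⋂ L, ⋂ M, {c | c (a :: L) ≠ none →
        c (M ++ letterInv a :: a :: L) = c (M ++ L)}) := by
    ext c
    simp only [Set.mem_inter_iff, Set.mem_iInter, Set.mem_ofPred_eq]
    exact ⟨fun h => ⟨⟨⟨⟨⟨h.1, h.2⟩, h.3⟩, h.4⟩, h.5⟩, h.6⟩,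
      fun ⟨⟨⟨⟨⟨h1, h2⟩, h3⟩, h4⟩, h5⟩, h6⟩ => ⟨h1, h2, h3, h4, h5, h6⟩⟩
  rw [h]
  refine ((((IsClosed.inter ?_ ?_).inter ?_).inter ?_).inter ?_).inter ?_
  · exact isClosed_setOf (fun _ : Unit => []) fun x => x () ≠ none
  · refine isClosed_iInter fun a => isClosed_iInter fun L => ?_
    exact isClosed_setOf (fun b : Bool => if b then a :: L else L) fun x => x true ≠ none →
      x false = some (E.letterCod (letterInv a)) ∧ x true = some (E.letterCod a)
  · refine isClosed_iInter fun x => isClosed_iInter fun L => ?_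
    exact isClosed_setOf (fun b : Bool => if b then (x, true) :: L else L) fun y =>
      y false = some (Sum.inr (E.s x)) → y true ≠ none
  · refine isClosed_iInter fun X => isClosed_iInter fun L => ?_
    exact isClosed_setOf (fun o : Option E.Edge => o.elim L fun x => (x, false) :: L) fun y =>
      y none = some (Sum.inl (E.base X)) → ∃ x, E.grp x = X ∧ y (some x) ≠ none
  · refine isClosed_iInter fun x => isClosed_iInter fun x' => isClosed_iInter fun L => ?_
    exact isClosed_setOf (fun b : Bool => if b then (x, false) :: L else (x', false) :: L) fun y =>
      E.grp x = E.grp x' → y true ≠ none → y false ≠ none → x = x'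
  · refine isClosed_iInter fun a => isClosed_iInter fun L => isClosed_iInter fun M => ?_
    exact isClosed_setOf (fun o : Option Bool => o.elim (a :: L) fun b =>
      if b then M ++ letterInv a :: a :: L else M ++ L) fun y =>
      y none ≠ none → y (some true) = y (some false)

theorem isClopen_setOf (L : List (E.Edge × Bool)) (P : Option (E.V0 ⊕ E.V1) → Prop) :
    IsClopen {c : E.CodeSpace | P (c.1 L)} :=
  (isClopen_discrete {x | P x}).preimage ((continuous_apply L).comp continuous_subtype_val)

theorem continuousOn_step (a : E.Edge × Bool) :
    ContinuousOn (step a) {c : E.CodeSpace | c.1 [a] ≠ none} := by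
  have hi : Topology.IsInducing (Subtype.val : E.CodeSpace → _) := ⟨rfl⟩
  refine hi.continuousOn_iff.2 (continuousOn_pi.2 fun L => ?_)
  have h : Continuous fun c : E.CodeSpace => c.1 (L ++ [a]) :=
    (continuous_apply _).comp continuous_subtype_val
  exact h.continuousOn.congr fun c hc => step_apply hc L

/-- The dynamical system of all codes. -/
noncomputable def system (E : BipSepGraph.{u}) [Finite E.V0] [Finite E.V1] [Finite E.Edge] :
    E.DynSystem where
  Pt := E.CodeSpace
  compact := isCompact_iff_compactSpace.1 isClosed_isCode.isCompact
  Ω v := {c | c.1 [] = some v}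
  isClopen_Ω v := isClopen_setOf [] (· = some v)
  Ω_cover c := by
    obtain ⟨v, hv⟩ := Option.ne_none_iff_exists'.1 c.2.nil
    exact ⟨v, hv, fun w hw => Option.some_inj.1 (Eq.trans (Eq.symm hw) hv)⟩
  θ x :=
    { toFun := step (x, true)
      invFun := step (x, false)
      source := {c | c.1 [(x, true)] ≠ none}
      target := {c | c.1 [(x, false)] ≠ none}
      map_source' := fun _ h => step_inv_ne_none h
      map_target' := fun _ h => step_inv_ne_none h
      left_inv' := fun _ h => step_inv_step h
      right_inv' := fun _ h => step_inv_step h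
      open_source := (isClopen_setOf _ (· ≠ none)).isOpen
      open_target := (isClopen_setOf _ (· ≠ none)).isOpen
      continuousOn_toFun := continuousOn_step _
      continuousOn_invFun := continuousOn_step _ }
  source_θ x := Set.ext fun c => ⟨fun h => (c.2.cons _ _ h).1, fun h => c.2.fwd x [] h⟩
  isClopen_target x := isClopen_setOf _ (· ≠ none)
  iUnion_target X := by
    ext c
    simp only [Set.mem_iUnion]
    constructor
    · rintro ⟨⟨x, rfl⟩, h⟩
      exact (c.2.cons _ _ h).1
    · intro h
      obtain ⟨x, hx, h'⟩ := c.2.bwd X [] h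
      exact ⟨⟨x, hx⟩, h'⟩
  disjoint_target x y h hne :=
    Set.disjoint_left.2 fun c hx hy => hne (c.2.bwd_unique x y [] h hx hy)

theorem continuous_of_isOpen [Finite E.V0] [Finite E.V1] [Finite E.Edge] {P : Type*}
    [TopologicalSpace P] {f : P → (system E).Pt}
    (h : ∀ L o, IsOpen {p | (show E.CodeSpace from f p).1 L = o}) : Continuous f := by
  refine Topology.IsInducing.continuous_iff
    (g := (Subtype.val : E.CodeSpace → _)) ⟨rfl⟩ |>.2 (continuous_pi fun L => ?_)
  exact continuous_discrete_rng.2 fun o => h L o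

end CodeSpace

/-! ### Continuity of codes and universality -/

namespace DynSystem

theorem isClopen_source (S : E.DynSystem) (x : E.Edge) : IsClopen (S.θ x).source :=
  S.source_θ x ▸ S.isClopen_Ω _

theorem isClopen_exists_step (S : E.DynSystem) (a : E.Edge × Bool) {A : Set S.Pt}
    (hA : IsClopen A) : IsClopen {p : S.Pt | ∃ q ∈ A, S.flow.Step a p q} := by
  have key : ∀ e : OpenPartialHomeomorph S.Pt S.Pt, IsClopen e.source →
      IsClopen (e.source ∩ e ⁻¹' A) := fun e he =>
    ⟨e.continuousOn.preimage_isClosed_of_isClosed he.isClosed hA.isClosed,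
      e.continuousOn.isOpen_inter_preimage he.isOpen hA.isOpen⟩
  obtain ⟨x, _ | _⟩ := a
  · convert key (S.θ x).symm (S.isClopen_target x) using 1
    ext p
    constructor
    · rintro ⟨q, hq, h⟩
      obtain ⟨h1, rfl⟩ := S.flow_R.1 h
      exact ⟨(S.θ x).map_source h1, show (S.θ x).symm (S.θ x q) ∈ A by rwa [(S.θ x).left_inv h1]⟩
    · rintro ⟨h1, h2⟩
      exact ⟨_, h2, S.flow_R.2 ⟨(S.θ x).map_target h1, (S.θ x).right_inv h1⟩⟩
  · convert key (S.θ x) (S.isClopen_source x) using 1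
    ext p
    constructor
    · rintro ⟨q, hq, h⟩
      obtain ⟨h1, rfl⟩ := S.flow_R.1 h
      exact ⟨h1, hq⟩
    · rintro ⟨h1, h2⟩
      exact ⟨_, h2, S.flow_R.2 ⟨h1, rfl⟩⟩

theorem isClopen_exists_reach (S : E.DynSystem) (L : List (E.Edge × Bool)) {A : Set S.Pt}
    (hA : IsClopen A) : IsClopen {p : S.Pt | ∃ q ∈ A, S.flow.Reach L p q} := by
  induction L generalizing A with
  | nil =>
    convert hA using 1
    ext p
    exact ⟨fun ⟨q, hq, h⟩ => Eq.symm h ▸ hq, fun h => ⟨p, h, rfl⟩⟩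
  | cons a L ih =>
    convert ih (S.isClopen_exists_step a hA) using 1
    ext p
    exact ⟨fun ⟨q, hq, m, h1, h2⟩ => ⟨m, ⟨q, hq, h2⟩, h1⟩,
      fun ⟨m, ⟨q, hq, h2⟩, h1⟩ => ⟨q, hq, m, h1, h2⟩⟩

theorem isClopen_code_eq (S : E.DynSystem) (L : List (E.Edge × Bool))
    (o : Option (E.V0 ⊕ E.V1)) : IsClopen {p : S.Pt | S.flow.code p L = o} := by
  rcases o with _ | v
  · have h := (S.isClopen_exists_reach L isClopen_univ).compl
    convert h using 1
    ext p
    exact Flow.code_eq_none.trans (not_congr ⟨fun ⟨q, h⟩ => ⟨q, trivial, h⟩, fun ⟨q, _, h⟩ => ⟨q, h⟩⟩)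
  · convert S.isClopen_exists_reach L (S.isClopen_Ω v) using 1
    ext p
    exact Flow.code_eq_some.trans ⟨fun ⟨q, h, h'⟩ => ⟨q, S.flow_cls_eq.1 h', h⟩,
      fun ⟨q, h', h⟩ => ⟨q, h, S.flow_cls_eq.2 h'⟩⟩

/-- Preservation of the sets H_x is automatic, since H_x is the image of θ_x. -/
theorem isEquivariant_iff_hom {S T : E.DynSystem} {f : S.Pt → T.Pt} :
    IsEquivariant S T f ↔ S.flow.Hom T.flow f := by
  constructor
  · rintro ⟨h1, -, h3⟩
    refine ⟨fun p => T.flow_cls_eq.2 (h1 _ p (S.flow_cls_eq.1 rfl)), fun {x p q} h => ?_⟩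
    obtain ⟨h4, h5⟩ := h
    subst h5
    exact ⟨h1 _ p h4, (h3 x p h4).symm⟩
  · refine fun h => ⟨fun v p hp => ?_, fun x p hp => ?_, fun x p hp => ?_⟩
    · exact T.flow_cls_eq.1 ((h.cls p).trans (S.flow_cls_eq.2 hp))
    · exact T.mem_H_iff.2 ((S.mem_H_iff.1 hp).imp' f fun _ => h.R)
    · exact (h.R (x := x) (p := p) ⟨hp, rfl⟩).2.symm

end DynSystem

namespace CodeSpace

variable [Finite E.V0] [Finite E.V1] [Finite E.Edge]

theorem flow_step_iff {a : E.Edge × Bool} {c c' : E.CodeSpace} :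
    (system E).flow.Step a c c' ↔ c.1 [a] ≠ none ∧ step a c = c' := by
  obtain ⟨x, _ | _⟩ := a
  · refine (system E).flow_R.trans ⟨?_, ?_⟩
    · rintro ⟨h, rfl⟩
      exact ⟨step_inv_ne_none h, step_inv_step h⟩
    · rintro ⟨h, rfl⟩
      exact ⟨step_inv_ne_none h, step_inv_step h⟩
  · exact (system E).flow_R

theorem flow_cls_iff {c : E.CodeSpace} {v : E.V0 ⊕ E.V1} :
    (system E).flow.cls c = v ↔ c.1 [] = some v := (system E).flow_cls_eq

/-- With invariance of codes under maps of flows, this leaves only one possible map to the system of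
codes. -/
theorem flow_code (c : E.CodeSpace) : (system E).flow.code c = c.1 := by
  funext L
  induction L using List.reverseRecOn generalizing c with
  | nil => exact ((system E).flow.code_nil c).trans (flow_cls_iff.1 rfl).symm
  | append_singleton L a ih =>
    by_cases h : c.1 [a] = none
    · rw [c.2.append_eq_none h]
      exact Flow.code_append_eq_none (fun ⟨c', h'⟩ => (flow_step_iff.1 h').1 h) L
    · exact (Flow.Step.code_append (flow_step_iff.2 ⟨h, rfl⟩) L).trans
        ((ih _).trans (step_apply h L))

theorem hom_code (F : E.Flow) :
    F.Hom (system E).flow (fun p => (⟨F.code p, F.isCode_code p⟩ : E.CodeSpace)) := by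
  refine ⟨fun p => flow_cls_iff.2 (F.code_nil p), fun {x p q} h => ?_⟩
  have hs : F.Step (x, true) p q := h
  have hne : F.code p [(x, true)] ≠ none := Flow.code_singleton_ne_none.2 ⟨q, hs⟩
  refine (flow_step_iff (a := (x, true)) (c := ⟨F.code p, F.isCode_code p⟩)).2 ⟨hne, Subtype.ext (funext fun L => ?_)⟩
  exact (step_apply (c := ⟨F.code p, F.isCode_code p⟩) hne L).trans (hs.code_append L)

theorem eq_of_hom {F : E.Flow} {f : F.Pt → E.CodeSpace} (hf : F.Hom (system E).flow f) (p : F.Pt) :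
    f p = ⟨F.code p, F.isCode_code p⟩ :=
  Subtype.ext ((flow_code (f p)).symm.trans (hf.code_eq p))

/-- The equivariant map to the system of codes. -/
noncomputable def codeMap (S : E.DynSystem) : C(S.Pt, (system E).Pt) where
  toFun p := show E.CodeSpace from ⟨S.flow.code p, S.flow.isCode_code p⟩
  continuous_toFun := continuous_of_isOpen fun L o => (S.isClopen_code_eq L o).isOpen

theorem isUniversal_system : (system E).IsUniversal := fun T =>
  ⟨codeMap T, DynSystem.isEquivariant_iff_hom.2 (hom_code T.flow), fun _ hf =>
    ContinuousMap.ext fun p => eq_of_hom (DynSystem.isEquivariant_iff_hom.1 hf) p⟩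

end CodeSpace

namespace DynSystem

variable [Finite E.V0] [Finite E.V1] [Finite E.Edge]

/-- The flow needs no topology: it maps to the system of codes, which is a genuine dynamical system
and so maps to `S`. -/
theorem IsUniversal.exists_hom {S : E.DynSystem} (hS : S.IsUniversal) (F : E.Flow) :
    ∃ f, F.Hom S.flow f := by
  obtain ⟨k, hk, -⟩ := hS (CodeSpace.system E)
  exact ⟨_, (isEquivariant_iff_hom.1 hk).comp (CodeSpace.hom_code F)⟩

/-- Going to the codes and back is an equivariant self-map of `S`, hence the identity. -/
theorem IsUniversal.code_injective {S : E.DynSystem} (hS : S.IsUniversal) {p q : S.Pt}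
    (h : S.flow.code p = S.flow.code q) : p = q := by
  obtain ⟨k, hk, -⟩ := hS (CodeSpace.system E)
  have h1 : IsEquivariant S S (k.comp (CodeSpace.codeMap S)) :=
    isEquivariant_iff_hom.2 ((isEquivariant_iff_hom.1 hk).comp (CodeSpace.hom_code S.flow))
  have h2 : IsEquivariant S S (ContinuousMap.id S.Pt) :=
    isEquivariant_iff_hom.2 ⟨fun _ => rfl, id⟩
  have h3 := (hS S).unique h1 h2
  have h4 : CodeSpace.codeMap S p = CodeSpace.codeMap S q := Subtype.ext h
  calc p = k.comp (CodeSpace.codeMap S) p := by rw [h3]; rfl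
    _ = k.comp (CodeSpace.codeMap S) q := congrArg k h4
    _ = q := by rw [h3]; rfl

end DynSystem

/-! ### Trees -/

/-- The class of the node of a tree rooted at `w` that is reached along a word. -/
def nodeCls (E : BipSepGraph.{u}) (w : E.V1) : List (E.Edge × Bool) → E.V0 ⊕ E.V1
  | [] => Sum.inr w
  | a :: _ => E.letterCod a

/-- The words without backtracking that start at `w` and follow the choices given by `ch`. -/
inductive Valid (w : E.V1) (ch : List (E.Edge × Bool) → ∀ x : E.Edge, E.Z (E.grp x)) :
    List (E.Edge × Bool) → Prop
  | nil : Valid w ch []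
  | out {L x} : Valid w ch L → E.nodeCls w L = Sum.inr (E.s x) → L.head? ≠ some (x, false) →
      Valid w ch ((x, true) :: L)
  | back {L x} (Y : E.Others (E.grp x)) : Valid w ch ((x, true) :: L) →
      Valid w ch (((ch ((x, true) :: L) x Y).1, false) :: (x, true) :: L)

namespace Valid

variable {w : E.V1} {ch : List (E.Edge × Bool) → ∀ x : E.Edge, E.Z (E.grp x)}

theorem of_cons {a : E.Edge × Bool} {L : List (E.Edge × Bool)} (h : Valid w ch (a :: L)) :
    Valid w ch L := by
  cases h <;> assumption

theorem inv_out {x : E.Edge} {L : List (E.Edge × Bool)} (h : Valid w ch ((x, true) :: L)) :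
    E.nodeCls w L = Sum.inr (E.s x) ∧ L.head? ≠ some (x, false) := by
  cases h with
  | out _ h1 h2 => exact ⟨h1, h2⟩

theorem inv_back {y : E.Edge} {M : List (E.Edge × Bool)} (h : Valid w ch ((y, false) :: M)) :
    ∃ x L, ∃ Y : E.Others (E.grp x), M = (x, true) :: L ∧ y = (ch M x Y).1 := by
  cases h with
  | back Y h => exact ⟨_, _, Y, rfl, rfl⟩

theorem even_length {L : List (E.Edge × Bool)} (h : Valid w ch L) : ∀ x M,
    L = (x, true) :: M → Even M.length := by
  induction L using List.twoStepInduction with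
  | nil => simp
  | singleton a => simp
  | cons_cons a b L ih _ =>
    rintro x M h'
    obtain ⟨rfl, rfl⟩ := List.cons.inj h'
    obtain ⟨y, _ | _⟩ := b
    · obtain ⟨x, L, Y, rfl, -⟩ := h.of_cons.inv_back
      exact (ih h.of_cons.of_cons x L rfl).add (by decide : Even 2)
    · exact absurd h.inv_out.1 (by simp [nodeCls, letterCod])

end Valid

/-- The flow on the valid words. -/
def tree (w : E.V1) (ch : List (E.Edge × Bool) → ∀ x : E.Edge, E.Z (E.grp x)) : E.Flow where
  Pt := {L // Valid w ch L}
  cls p := E.nodeCls w p.1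
  R x p q := q.1 = (x, true) :: p.1 ∨ p.1 = (x, false) :: q.1
  cls_left := by
    rintro x ⟨p, hp⟩ ⟨q, hq⟩ (h | h) <;> dsimp only at h <;> subst h
    · exact hq.inv_out.1
    · rfl
  cls_right := by
    rintro x ⟨p, hp⟩ ⟨q, hq⟩ (h | h) <;> dsimp only at h <;> subst h
    · rfl
    · obtain ⟨x', L, Y, rfl, h⟩ := hp.inv_back
      refine congrArg Sum.inl ?_
      rw [r, r, h, (ch _ x' Y).2, Y.2.1]
  exists_fwd := by
    rintro x ⟨p, hp⟩ h
    -- If the node was reached through `x⁻¹`, then `x` undoes that step; otherwise it opens a new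
    -- branch.
    by_cases h' : p.head? = some (x, false)
    · obtain ⟨q, rfl⟩ := List.head?_eq_some_iff.1 h'
      exact ⟨⟨q, hp.of_cons⟩, Or.inr rfl⟩
    · exact ⟨⟨_, hp.out h h'⟩, Or.inl rfl⟩
  unique_fwd := by
    rintro x ⟨p, hp⟩ ⟨q, hq⟩ ⟨q', hq'⟩ (h | h) (h' | h') <;> refine Subtype.ext ?_ <;>
      dsimp only at h h' ⊢
    · exact h.trans h'.symm
    · subst h h'
      exact absurd rfl hq.inv_out.2
    · subst h h'
      exact absurd rfl hq'.inv_out.2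
    · exact (List.cons.inj (h.symm.trans h')).2
  exists_bwd := by
    rintro X ⟨q, hq⟩ h
    obtain _ | ⟨⟨x, _ | _⟩, L⟩ := q
    · exact absurd h (by simp [nodeCls])
    · exact absurd h (by simp [nodeCls, letterCod])
    · by_cases hX : X = E.grp x
      · exact ⟨x, ⟨L, hq.of_cons⟩, hX.symm, Or.inl rfl⟩
      · exact ⟨_, ⟨_, hq.back ⟨X, (Sum.inl_injective h).symm, hX⟩⟩,
          (ch ((x, true) :: L) x ⟨X, (Sum.inl_injective h).symm, hX⟩).2, Or.inr rfl⟩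
  unique_bwd := by
    -- A retreat along the arriving edge and a chosen backward edge never share a block, because
    -- choices avoid the block of the arriving edge.
    have key : ∀ {x x' p p' q}, Valid w ch q → Valid w ch p' → q = (x, true) :: p →
        p' = (x', false) :: q → E.grp x = E.grp x' → False := by
      rintro x x' p p' q hq hp' rfl rfl h
      obtain ⟨x₁, L, Y, h1, h2⟩ := hp'.inv_back
      obtain ⟨h3, -⟩ := List.cons.inj h1
      obtain rfl : x = x₁ := congrArg Prod.fst h3
      exact Y.2.2 ((ch _ _ Y).2.symm.trans ((congrArg E.grp h2.symm).trans h.symm))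
    rintro x x' ⟨p, hp⟩ ⟨p', hp'⟩ ⟨q, hq⟩ (h | h) (h' | h') hx <;> dsimp only at h h'
    · obtain ⟨h1, h2⟩ := List.cons.inj (h.symm.trans h')
      exact ⟨congrArg Prod.fst h1, Subtype.ext h2⟩
    · exact (key hq hp' h h' hx).elim
    · exact (key hq hp h' h hx.symm).elim
    · subst h h'
      obtain ⟨x₁, L, Y, rfl, h2⟩ := hp.inv_back
      obtain ⟨x₂, L', Y', h1, h3⟩ := hp'.inv_back
      obtain ⟨h4, rfl⟩ := List.cons.inj h1
      obtain rfl : x₁ = x₂ := congrArg Prod.fst h4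
      obtain rfl : Y = Y' := by
        refine Subtype.ext ?_
        rw [← (ch _ _ Y).2, ← (ch _ _ Y').2, ← h2, ← h3, hx]
      obtain rfl := h2.trans h3.symm
      exact ⟨rfl, rfl⟩

section Tree

variable {w : E.V1} {ch : List (E.Edge × Bool) → ∀ x : E.Edge, E.Z (E.grp x)}

theorem tree_reach {L : List (E.Edge × Bool)} (h : Valid w ch L) :
    (tree w ch).Reach L ⟨[], Valid.nil⟩ ⟨L, h⟩ := by
  induction h with
  | nil => rfl
  | out h _ _ ih => exact ⟨_, ih, Or.inl rfl⟩
  | back Y h ih => exact ⟨_, ih, Or.inr rfl⟩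

theorem tree_step_length {a : E.Edge × Bool} {M M' : (tree w ch).Pt}
    (h : (tree w ch).Step a M M') : M'.1.length ≤ M.1.length + 1 := by
  obtain ⟨x, _ | _⟩ := a <;> rcases h with h | h <;> simp [h] <;> omega

/-- A flow whose points follow the choices `ch` up to length `n` looks like the tree of `ch`. -/
theorem code_eq_tree_code {F : E.Flow} {p : F.Pt} {n : ℕ} (hp : F.cls p = Sum.inr w)
    (H : ∀ x L Y m, Valid w ch ((x, true) :: L) → L.length + 1 < n →
      F.Reach ((x, true) :: L) p m → ∃ m', F.R (ch ((x, true) :: L) x Y).1 m' m)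
    (L : List (E.Edge × Bool)) (hL : L.length ≤ n) :
    F.code p L = (tree w ch).code ⟨[], Valid.nil⟩ L := by
  have hcls : ∀ (M : (tree w ch).Pt) m, F.Reach M.1 p m → F.cls m = (tree w ch).cls M := by
    rintro ⟨_ | ⟨a, M⟩, hM⟩ m h
    · exact (congrArg F.cls h.symm).trans hp
    · obtain ⟨m', -, h2⟩ := h
      exact h2.cls_target
  -- A node corresponds to the point of `F` reached along it. This fact and the next make the
  -- correspondence a bisimulation below depth `n`.
  have hA : ∀ a (M M' : (tree w ch).Pt) m, M.1.length < n → (tree w ch).Step a M M' →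
      F.Reach M.1 p m → ∃ m', F.Step a m m' ∧ F.Reach M'.1 p m' := by
    rintro ⟨x, _ | _⟩ ⟨M, hM⟩ ⟨M', hM'⟩ m hn (h | h) hm <;> dsimp only at h hm hn
    · subst h
      obtain ⟨m', h1, h2⟩ := hm
      exact ⟨m', h2, h1⟩
    · subst h
      obtain ⟨x', L, Y, rfl, rfl⟩ := hM'.inv_back
      obtain ⟨m', hm'⟩ := H x' L Y m hM hn hm
      exact ⟨m', hm', m, hm, hm'⟩
    · subst h
      obtain ⟨m', hm'⟩ := F.exists_fwd ((hcls ⟨M, hM⟩ m hm).trans hM'.inv_out.1)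
      exact ⟨m', hm', m, hm, hm'⟩
    · subst h
      obtain ⟨m', h1, h2⟩ := hm
      exact ⟨m', h2, h1⟩
  have hB : ∀ a (M : (tree w ch).Pt) m m', M.1.length < n → F.Step a m m' →
      F.Reach M.1 p m → ∃ M', (tree w ch).Step a M M' := by
    rintro ⟨x, _ | _⟩ M m m' hn h hm
    · obtain ⟨x', M', hx, h1⟩ := (tree w ch).exists_bwd
        ((hcls M m hm).symm.trans (F.cls_right h))
      obtain ⟨m'', h2, -⟩ := hA (x', false) M M' m hn h1 hm
      obtain rfl := (F.unique_bwd h2 h hx).1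
      exact ⟨M', h1⟩
    · exact (tree w ch).exists_fwd ((hcls M m hm).symm.trans (F.cls_left h))
  -- `L` may backtrack, whereas the node `M` does not; both lead from `p` to the same point of `F`.
  have key : (∀ M, (tree w ch).Reach L ⟨[], Valid.nil⟩ M → M.1.length ≤ L.length ∧
      ∃ m, F.Reach L p m ∧ F.Reach M.1 p m) ∧
      ∀ m, F.Reach L p m → ∃ M, (tree w ch).Reach L ⟨[], Valid.nil⟩ M := by
    induction L with
    | nil =>
      refine ⟨?_, fun m _ => ⟨_, rfl⟩⟩
      rintro M rfl
      exact ⟨le_rfl, p, rfl, rfl⟩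
    | cons a L ih =>
      rw [List.length_cons] at hL
      obtain ⟨ih1, ih2⟩ := ih (by omega)
      constructor
      · rintro M ⟨M₀, h1, h2⟩
        obtain ⟨h3, m₀, h4, h5⟩ := ih1 M₀ h1
        obtain ⟨m, h6, h7⟩ := hA a M₀ M m₀ (by omega) h2 h5
        have := tree_step_length h2
        exact ⟨by rw [List.length_cons]; omega, m, ⟨m₀, h4, h6⟩, h7⟩
      · rintro m ⟨m₀, h1, h2⟩
        obtain ⟨M₀, h3⟩ := ih2 m₀ h1
        obtain ⟨h4, m₁, h5, h6⟩ := ih1 M₀ h3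
        obtain rfl := h1.unique h5
        obtain ⟨M, hM⟩ := hB a M₀ m₀ m (by omega) h2 h6
        exact ⟨M, M₀, h3, hM⟩
  refine (Flow.code_eq_code (fun M hM => ?_) key.2).symm
  obtain ⟨-, m, h1, h2⟩ := key.1 M hM
  exact ⟨m, h1, (hcls M m h2).symm⟩

end Tree

/-! ### `E`-functions of points -/

open scoped Classical in
/-- The reduced word of an element of the free group. -/
noncomputable def word (g : FreeGroup E.Edge) : List (E.Edge × Bool) := g.toWord

theorem mk_word (g : FreeGroup E.Edge) : FreeGroup.mk (word g) = g := by
  classical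
  exact FreeGroup.mk_toWord

theorem word_of (e : E.Edge) : word (FreeGroup.of e) = [(e, true)] := by
  classical
  exact FreeGroup.toWord_of e

/-- The two inequalities exclude cancellation, so words grow by two letters at each stage. -/
theorem word_next {g : FreeGroup E.Edge} {x y e : E.Edge} {L : List (E.Edge × Bool)}
    (h : word g = (x, true) :: L) (hy : y ≠ x) (he : e ≠ y) :
    word (FreeGroup.of e * (FreeGroup.of y)⁻¹ * g) = (e, true) :: (y, false) :: (x, true) :: L := by
  classical
  have h0 : FreeGroup.IsReduced ((x, true) :: L) := h ▸ FreeGroup.isReduced_toWord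
  have h1 : FreeGroup.IsReduced ((e, true) :: (y, false) :: (x, true) :: L) := by
    unfold FreeGroup.IsReduced at *
    refine List.isChain_cons_cons.2 ⟨fun h => absurd h he, List.isChain_cons_cons.2
      ⟨fun h => absurd h hy, h0⟩⟩
  have h2 : FreeGroup.of e * (FreeGroup.of y)⁻¹ * g =
      FreeGroup.mk ((e, true) :: (y, false) :: (x, true) :: L) := by
    conv_lhs => rw [← mk_word g, h]
    rfl
  rw [h2, word, FreeGroup.toWord_mk, h1.reduce_eq]

theorem IsFirst.inv {w : E.V1} {f : E.LocalFun} (h : E.IsFirst w f) {g c} (hg : f g = some c) :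
    ∃ e, E.s e = w ∧ g = FreeGroup.of e ∧ c.1 = E.grp e := by
  obtain ⟨e, he, rfl⟩ := h.1.subset ⟨c, hg⟩
  exact ⟨e, he, rfl, h.2 e c hg⟩

theorem IsFirst.exists {w : E.V1} {f : E.LocalFun} (h : E.IsFirst w f) {e} (he : E.s e = w) :
    ∃ c, f (FreeGroup.of e) = some c ∧ c.1 = E.grp e := by
  obtain ⟨c, hc⟩ := h.1.superset ⟨e, he, rfl⟩
  exact ⟨c, hc, h.2 e c hc⟩

theorem IsNext.inv {f f' : E.LocalFun} (h : E.IsNext f f') {g' c'} (hg : f' g' = some c') :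
    ∃ g c, f g = some c ∧ ∃ Y : E.Others c.1, ∃ e, E.s e = E.s (c.2 Y).1 ∧ e ≠ (c.2 Y).1 ∧
      g' = FreeGroup.of e * (FreeGroup.of (c.2 Y).1)⁻¹ * g ∧ c'.1 = E.grp e := by
  obtain ⟨g, c, hc, Y, e, h1, h2, rfl⟩ := h.1.subset ⟨c', hg⟩
  exact ⟨g, c, hc, Y, e, h1, h2, rfl, h.2 g c hc Y e h1 h2 c' hg⟩

theorem IsNext.exists {f f' : E.LocalFun} (h : E.IsNext f f') {g c} (hg : f g = some c)
    {Y : E.Others c.1} {e} (h1 : E.s e = E.s (c.2 Y).1) (h2 : e ≠ (c.2 Y).1) :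
    ∃ c', f' (FreeGroup.of e * (FreeGroup.of (c.2 Y).1)⁻¹ * g) = some c' ∧ c'.1 = E.grp e := by
  obtain ⟨c', hc⟩ := h.1.superset ⟨g, c, hg, Y, e, h1, h2, rfl⟩
  exact ⟨c', hc, h.2 g c hg Y e h1 h2 c' hc⟩

/-- The functions `f 0, …, f j` form a partial `E`-function. -/
def Chain (w : E.V1) (f : ℕ → E.LocalFun) (j : ℕ) : Prop :=
  E.IsFirst w (f 0) ∧ ∀ i < j, E.IsNext (f i) (f (i + 1))

theorem Chain.mono {w : E.V1} {f : ℕ → E.LocalFun} {i j : ℕ} (h : Chain w f j) (hij : i ≤ j) :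
    Chain w f i := ⟨h.1, fun k hk => h.2 k (hk.trans_le hij)⟩

theorem choice_ne {x : E.Edge} {c : E.Choice} (hc : c.1 = E.grp x) (Y : E.Others c.1) :
    (c.2 Y).1 ≠ x := fun h => Y.2.2 ((c.2 Y).2.symm.trans (h ▸ hc.symm))

theorem Chain.word_eq {w : E.V1} {f : ℕ → E.LocalFun} {j : ℕ} (h : Chain w f j) {g c}
    (hg : f j g = some c) : ∃ x L, word g = (x, true) :: L ∧ L.length = 2 * j ∧ c.1 = E.grp x := by
  induction j generalizing g c with
  | zero =>
    obtain ⟨e, -, rfl, hc⟩ := h.1.inv hg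
    exact ⟨e, [], word_of e, rfl, hc⟩
  | succ j ih =>
    obtain ⟨g, c, h1, Y, e, -, he, rfl, hc⟩ := (h.2 j (Nat.lt_succ_self j)).inv hg
    obtain ⟨x, L, h2, h3, h4⟩ := ih (h.mono (Nat.le_succ j)) h1
    refine ⟨e, _, word_next h2 (choice_ne h4 Y) he, ?_, hc⟩
    simp only [List.length_cons]
    omega

open scoped Classical in
/-- The choice function on words given by a sequence of functions `f j`. -/
noncomputable def treeChoice (f : ℕ → E.LocalFun) (L : List (E.Edge × Bool)) (x : E.Edge) :
    E.Z (E.grp x) :=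
  -- The words in the domain of `f j` have length 2j+1, so halving recovers `j`. All other words
  -- receive an arbitrary choice.
  if h : ∃ z, f (L.length / 2) (FreeGroup.mk L) = some ⟨E.grp x, z⟩ then h.choose
  else (E.exists_z _).some

theorem eq_treeChoice {f : ℕ → E.LocalFun} {j : ℕ} {g : FreeGroup E.Edge} {c : E.Choice}
    (hg : f j g = some c) {x : E.Edge} {L : List (E.Edge × Bool)} (hw : word g = (x, true) :: L)
    (hL : L.length = 2 * j) (hc : c.1 = E.grp x) :
    c = ⟨E.grp x, treeChoice f ((x, true) :: L) x⟩ := by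
  obtain ⟨X, z⟩ := c
  obtain rfl : X = E.grp x := hc
  have hj : ((x, true) :: L).length / 2 = j := by
    rw [List.length_cons]
    omega
  have key : f (((x, true) :: L).length / 2) (FreeGroup.mk ((x, true) :: L)) =
      some ⟨E.grp x, z⟩ := by rw [hj, ← hw, mk_word, hg]
  have h : ∃ z, f (((x, true) :: L).length / 2) (FreeGroup.mk ((x, true) :: L)) =
      some ⟨E.grp x, z⟩ := ⟨z, key⟩
  rw [treeChoice, dif_pos h]
  exact Option.some_inj.1 (key.symm.trans h.choose_spec)

theorem Chain.valid {w : E.V1} {f : ℕ → E.LocalFun} {j : ℕ} (h : Chain w f j) {g c}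
    (hg : f j g = some c) : Valid w (treeChoice f) (word g) := by
  induction j generalizing g c with
  | zero =>
    obtain ⟨e, rfl, rfl, -⟩ := h.1.inv hg
    rw [word_of]
    exact Valid.nil.out rfl (by simp)
  | succ j ih =>
    obtain ⟨g, c, h1, Y, e, hs, he, rfl, -⟩ := (h.2 j (Nat.lt_succ_self j)).inv hg
    have hj := h.mono (Nat.le_succ j)
    obtain ⟨x, L, h2, h3, h4⟩ := hj.word_eq h1
    have h5 := ih hj h1
    rw [word_next h2 (choice_ne h4 Y) he]
    rw [h2] at h5
    refine Valid.out ?_ (congrArg Sum.inr hs.symm) (by simpa using Ne.symm he)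
    obtain rfl := eq_treeChoice h1 h2 h3 h4
    exact h5.back Y

/-- Converse to `Chain.valid`: the domain of `f j` is exactly the set of valid words of length 2j+1
starting with a positive letter. -/
theorem Chain.exists_of_valid {w : E.V1} {f : ℕ → E.LocalFun} {j : ℕ} (h : Chain w f j)
    {x : E.Edge} {L : List (E.Edge × Bool)} (hv : Valid w (treeChoice f) ((x, true) :: L))
    (hL : L.length = 2 * j) : ∃ g c, word g = (x, true) :: L ∧ f j g = some c ∧
      c = ⟨E.grp x, treeChoice f ((x, true) :: L) x⟩ := by
  suffices H : ∃ g c, word g = (x, true) :: L ∧ f j g = some c ∧ c.1 = E.grp x by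
    obtain ⟨g, c, h1, h2, h3⟩ := H
    exact ⟨g, c, h1, h2, eq_treeChoice h2 h1 hL h3⟩
  induction j generalizing x L with
  | zero =>
    obtain rfl := List.length_eq_zero_iff.1 hL
    obtain ⟨c, hc, hx⟩ := h.1.exists (Sum.inr_injective hv.inv_out.1).symm
    exact ⟨_, c, word_of x, hc, hx⟩
  | succ j ih =>
    obtain _ | ⟨⟨y, _ | _⟩, L⟩ := L
    · simp at hL
    · obtain ⟨x₀, L, Y, rfl, rfl⟩ := hv.of_cons.inv_back
      have hL' : L.length = 2 * j := by
        simp only [List.length_cons] at hL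
        omega
      have hj := h.mono (Nat.le_succ j)
      obtain ⟨g, c, h1, h2, h3⟩ := ih hj hv.of_cons.of_cons hL'
      obtain rfl := eq_treeChoice h2 h1 hL' h3
      have he : x ≠ (treeChoice f ((x₀, true) :: L) x₀ Y).1 := fun e =>
        hv.inv_out.2 (by rw [← e]; rfl)
      obtain ⟨c', h4, h5⟩ := (h.2 j (Nat.lt_succ_self j)).exists h2 (Y := Y)
        (Sum.inr_injective hv.inv_out.1).symm he
      exact ⟨_, c', word_next h1 (choice_ne h3 Y) he, h4, h5⟩
    · exact absurd hv.inv_out.1 (by simp [nodeCls, letterCod])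

namespace Flow

/-- `F.Body p g c` says that `g` ends in an edge `x` with `c ∈ Z_{X_x}`, that `θ_g p` is defined,
and that it lies in the sets `H_y` for all components `y` of `c`. -/
def Body (F : E.Flow) (p : F.Pt) (g : FreeGroup E.Edge) (c : E.Choice) : Prop :=
  ∃ x L, word g = (x, true) :: L ∧ c.1 = E.grp x ∧
    ∃ q, F.Reach (word g) p q ∧ ∀ Y, ∃ q', F.R (c.2 Y).1 q' q

variable {F G : E.Flow} {p : F.Pt}

/-- A point lies in only one H_y for each block, so the dynamics leaves no freedom in the values of
an E-function. -/
theorem Body.unique {g : FreeGroup E.Edge} {c c' : E.Choice} (h : F.Body p g c)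
    (h' : F.Body p g c') : c = c' := by
  obtain ⟨x, L, h1, h2, q, h3, h4⟩ := h
  obtain ⟨x', L', h1', h2', q', h3', h4'⟩ := h'
  obtain ⟨rfl, -⟩ := Prod.mk.inj (List.cons.inj (h1.symm.trans h1')).1
  obtain rfl := h3.unique h3'
  obtain ⟨X, z⟩ := c
  obtain ⟨X', z'⟩ := c'
  obtain rfl : X = X' := h2.trans h2'.symm
  refine congrArg (Sigma.mk X) (funext fun Y => Subtype.ext ?_)
  obtain ⟨m, hm⟩ := h4 Y
  obtain ⟨m', hm'⟩ := h4' Y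
  exact (F.unique_bwd hm hm' ((z Y).2.trans (z' Y).2.symm)).1

theorem Hom.body {f : F.Pt → G.Pt} (hf : F.Hom G f) {g : FreeGroup E.Edge} {c : E.Choice}
    (h : F.Body p g c) : G.Body (f p) g c := by
  obtain ⟨x, L, h1, h2, q, h3, h4⟩ := h
  exact ⟨x, L, h1, h2, f q, hf.reach h3, fun Y => (h4 Y).imp' f fun _ => hf.R⟩

theorem exists_body {g : FreeGroup E.Edge} {x : E.Edge} {L : List (E.Edge × Bool)}
    (hg : word g = (x, true) :: L) {q : F.Pt} (hq : F.Reach (word g) p q) : ∃ c, F.Body p g c := by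
  have h : ∀ Y : E.Others (E.grp x), ∃ y : E.Blk Y.1, ∃ q', F.R y.1 q' q := fun Y => by
    have hq' := hq
    rw [hg] at hq'
    obtain ⟨m, -, hm⟩ := hq'
    obtain ⟨y, q', hy, h⟩ := F.exists_bwd (X := Y.1)
      ((F.cls_right hm).trans (congrArg Sum.inl Y.2.1.symm))
    exact ⟨⟨y, hy⟩, q', h⟩
  choose z hz using h
  exact ⟨⟨E.grp x, z⟩, x, L, hg, rfl, q, hq, hz⟩

theorem exists_body_of {g : FreeGroup E.Edge} {e : E.Edge} (hp : F.cls p = Sum.inr (E.s e))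
    (hg : g = FreeGroup.of e) : ∃ c, F.Body p g c := by
  subst hg
  obtain ⟨q, hq⟩ := F.exists_fwd hp
  exact exists_body (word_of e) (q := q) (by rw [word_of]; exact ⟨p, rfl, hq⟩)

theorem Body.next {g : FreeGroup E.Edge} {c : E.Choice} (h : F.Body p g c) {Y : E.Others c.1}
    {e : E.Edge} (hs : E.s e = E.s (c.2 Y).1) (he : e ≠ (c.2 Y).1) :
    ∃ c', F.Body p (FreeGroup.of e * (FreeGroup.of (c.2 Y).1)⁻¹ * g) c' := by
  obtain ⟨x, L, h1, h2, q, h3, h4⟩ := h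
  obtain ⟨m, hm⟩ := h4 Y
  obtain ⟨k, hk⟩ := F.exists_fwd (p := m) (x := e) (by rw [F.cls_left hm, hs])
  have hw := word_next h1 (choice_ne h2 Y) he
  refine exists_body hw (q := k) ?_
  rw [h1] at h3
  rw [hw]
  exact ⟨m, ⟨q, h3, hm⟩, hk⟩

theorem Body.fst_eq {g : FreeGroup E.Edge} {c : E.Choice} (h : F.Body p g c) {x : E.Edge}
    {L : List (E.Edge × Bool)} (hg : word g = (x, true) :: L) : c.1 = E.grp x := by
  obtain ⟨x', L', h1, h2, -⟩ := h
  obtain ⟨rfl, -⟩ := Prod.mk.inj (List.cons.inj (h1.symm.trans hg)).1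
  exact h2

theorem exists_localFun (p : F.Pt) (A : Set (FreeGroup E.Edge)) (hA : ∀ g ∈ A, ∃ c, F.Body p g c) :
    ∃ f : E.LocalFun, E.dom f = A ∧ ∀ g c, f g = some c → F.Body p g c := by
  classical
  refine ⟨fun g => if h : g ∈ A then some (hA g h).choose else none, Set.ext fun g => ?_,
    fun g c h => ?_⟩
  · constructor
    · rintro ⟨c, hc⟩
      by_contra h
      simp [h] at hc
    · exact fun h => ⟨_, dif_pos h⟩
  · dsimp only at h
    split_ifs at h with hg
    exact Option.some_inj.1 h ▸ (hA g hg).choose_spec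

theorem exists_first {w : E.V1} (hp : F.cls p = Sum.inr w) :
    ∃ f, E.IsFirst w f ∧ ∀ g c, f g = some c → F.Body p g c := by
  obtain ⟨f, h1, h2⟩ := exists_localFun p {g | ∃ e, E.s e = w ∧ g = FreeGroup.of e} (by
    rintro g ⟨e, rfl, hg⟩
    exact exists_body_of hp hg)
  exact ⟨f, ⟨h1, fun e c hc => (h2 _ c hc).fst_eq (word_of e)⟩, h2⟩

theorem exists_next {f : E.LocalFun} (hf : ∀ g c, f g = some c → F.Body p g c) :
    ∃ f', E.IsNext f f' ∧ ∀ g c, f' g = some c → F.Body p g c := by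
  obtain ⟨f', h1, h2⟩ := exists_localFun p {h | ∃ g c, f g = some c ∧ ∃ Y : E.Others c.1, ∃ e,
      E.s e = E.s (c.2 Y).1 ∧ e ≠ (c.2 Y).1 ∧
        h = FreeGroup.of e * (FreeGroup.of (c.2 Y).1)⁻¹ * g} (by
    rintro h ⟨g, c, hc, Y, e, hs, he, rfl⟩
    exact (hf g c hc).next hs he)
  refine ⟨f', ⟨h1, fun g c hc Y e hs he c' hc' => ?_⟩, h2⟩
  obtain ⟨x, L, h3, h4, -⟩ := hf g c hc
  exact (h2 _ c' hc').fst_eq (word_next h3 (choice_ne h4 Y) he)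

theorem exists_eFunction {w : E.V1} (hp : F.cls p = Sum.inr w) :
    ∃ 𝔣 : E.EFunction w, ∀ j g c, 𝔣.f j g = some c → F.Body p g c := by
  obtain ⟨f₀, h1, h2⟩ := exists_first hp
  choose nxt h3 h4 using fun f : {f : E.LocalFun // ∀ g c, f g = some c → F.Body p g c} =>
    exists_next f.2
  -- The recursion carries along the proof that the current function describes `p`; the next one
  -- cannot be built without it.
  let a : ℕ → {f : E.LocalFun // ∀ g c, f g = some c → F.Body p g c} :=
    fun n => Nat.rec ⟨f₀, h2⟩ (fun _ f => ⟨nxt f, h4 f⟩) n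
  exact ⟨⟨fun j => (a j).1, h1, fun j => h3 (a j)⟩, fun j => (a j).2⟩

theorem localFun_ext {f f' : E.LocalFun} (h : E.dom f = E.dom f')
    (hf : ∀ g c, f g = some c → F.Body p g c) (hf' : ∀ g c, f' g = some c → F.Body p g c) :
    f = f' := by
  funext g
  refine Option.ext fun c => ⟨fun hc => ?_, fun hc => ?_⟩
  · obtain ⟨c', hc'⟩ := h.subset ⟨c, hc⟩
    rw [(hf g c hc).unique (hf' g c' hc'), hc']
  · obtain ⟨c', hc'⟩ := h.superset ⟨c, hc⟩
    rw [(hf' g c hc).unique (hf g c' hc'), hc']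

/-- Each domain is determined by the previous function, and on a given domain the point determines
the values. -/
theorem eq_of_chain {w : E.V1} {f f' : ℕ → E.LocalFun} {j : ℕ} (h : Chain w f j)
    (h' : Chain w f' j) (hf : ∀ i ≤ j, ∀ g c, f i g = some c → F.Body p g c)
    (hf' : ∀ i ≤ j, ∀ g c, f' i g = some c → F.Body p g c) : f j = f' j := by
  refine localFun_ext ?_ (hf j le_rfl) (hf' j le_rfl)
  induction j with
  | zero => exact h.1.1.trans h'.1.1.symm
  | succ j ih =>
    have hj := Nat.le_succ j
    have h1 := ih (h.mono hj) (h'.mono hj) (fun i hi => hf i (hi.trans hj))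
      fun i hi => hf' i (hi.trans hj)
    rw [(h.2 j j.lt_succ_self).1, (h'.2 j j.lt_succ_self).1,
      localFun_ext h1 (hf j hj) (hf' j hj)]

theorem body_tree {w : E.V1} {f : ℕ → E.LocalFun} {j : ℕ} (h : Chain w f j) {g c}
    (hg : f j g = some c) : (tree w (treeChoice f)).Body ⟨[], Valid.nil⟩ g c := by
  obtain ⟨x, L, h1, h2, h3⟩ := h.word_eq hg
  have hv := h.valid hg
  refine ⟨x, L, h1, h3, ⟨word g, hv⟩, tree_reach hv, fun Y => ?_⟩
  rw [h1] at hv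
  obtain rfl := eq_treeChoice hg h1 h2 h3
  exact ⟨⟨_, hv.back Y⟩, Or.inr (congrArg (List.cons _) h1.symm)⟩

/-- Choices are read at nodes of length 2j+1 with j < r, and one backward letter follows; this gives
the bound 2r. -/
theorem code_eq_tree_code_of_body {w : E.V1} (hp : F.cls p = Sum.inr w) {f : ℕ → E.LocalFun}
    {r : ℕ} (h : ∀ j < r, Chain w f j) (hf : ∀ j < r, ∀ g c, f j g = some c → F.Body p g c)
    (L : List (E.Edge × Bool)) (hL : L.length ≤ 2 * r) :
    F.code p L = (tree w (treeChoice f)).code ⟨[], Valid.nil⟩ L := by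
  refine code_eq_tree_code hp (fun x M Y m hv hM hm => ?_) L hL
  obtain ⟨j, hj⟩ := hv.even_length x M rfl
  have hjr : j < r := by omega
  obtain ⟨g, c, h1, h2, rfl⟩ := (h j hjr).exists_of_valid hv (by omega)
  obtain ⟨-, -, -, -, q, h3, h4⟩ := hf j hjr g _ h2
  rw [h1] at h3
  obtain rfl := h3.unique hm
  exact h4 Y

theorem Body.of_agree {q : F.Pt} {n : ℕ} (h : F.Agree n p q) {g : FreeGroup E.Edge} {c : E.Choice}
    (hb : F.Body p g c) (hn : (word g).length < n) : F.Body q g c := by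
  obtain ⟨x, L, h1, h2, m, h3, h4⟩ := hb
  have h5 := code_ne_none.2 ⟨m, h3⟩
  rw [h _ hn.le] at h5
  obtain ⟨m', hm'⟩ := code_ne_none.1 h5
  refine ⟨x, L, h1, h2, m', hm', fun Y => ?_⟩
  obtain ⟨k, hk⟩ := h4 Y
  have h6 : F.code p (((c.2 Y).1, false) :: word g) ≠ none := code_ne_none.2 ⟨k, m, h3, hk⟩
  rw [h _ (by rw [List.length_cons]; omega)] at h6
  obtain ⟨k', m'', h7, h8⟩ := code_ne_none.1 h6
  obtain rfl := hm'.unique h7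
  exact ⟨k', h8⟩

end Flow

theorem EFunction.chain {w : E.V1} (𝔣 : E.EFunction w) (j : ℕ) : Chain w 𝔣.f j :=
  ⟨𝔣.first, fun i _ => 𝔣.step i⟩

theorem EFunction.truncate_eq_iff {w : E.V1} {𝔣 : E.EFunction w} {r : ℕ}
    {𝔤 : E.PartialEFunction w r} :
    𝔣.truncate r = 𝔤 ↔ ∀ j (h : j < r), 𝔣.f j = 𝔤.f ⟨j, h⟩ :=
  ⟨fun h _ _ => h ▸ rfl, fun h => PartialEFunction.ext (funext fun j => h j.1 j.2)⟩

/-- Equal terms give the same tree up to depth 2r. Conversely, checking a value at a word of length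
2i+1 takes one more letter, and 2i+2 ≤ 2r for i < r. -/
theorem Flow.forall_eq_iff_agree {F : E.Flow} {w : E.V1} {p q : F.Pt} (hp : F.cls p = Sum.inr w)
    (hq : F.cls q = Sum.inr w) {𝔣 𝔣' : E.EFunction w}
    (h : ∀ j g c, 𝔣.f j g = some c → F.Body p g c)
    (h' : ∀ j g c, 𝔣'.f j g = some c → F.Body q g c) (r : ℕ) :
    (∀ j < r, 𝔣.f j = 𝔣'.f j) ↔ F.Agree (2 * r) p q := by
  constructor
  · intro H L hL
    rw [code_eq_tree_code_of_body hp (fun j _ => 𝔣.chain j) (fun j _ => h j) L hL,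
      code_eq_tree_code_of_body hq (fun j _ => 𝔣.chain j) (fun j hj => H j hj ▸ h' j) L hL]
  · intro H j hj
    refine eq_of_chain (p := q) (𝔣.chain j) (𝔣'.chain j) (fun i hi g c hc => ?_) fun i _ => h' i
    refine (h i g c hc).of_agree H ?_
    obtain ⟨x, L, h1, h2, -⟩ := (𝔣.chain i).word_eq hc
    rw [h1, List.length_cons]
    omega

/-! ### Realization, cylinders and vertices -/

namespace DynSystem

theorem records_of_body (S : E.DynSystem) {w : E.V1} {ξ : S.Pt} {𝔣 : E.EFunction w}
    (h : ∀ j g c, 𝔣.f j g = some c → S.flow.Body ξ g c) : S.Records ξ 𝔣 := by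
  intro j g c hc
  obtain ⟨x, L, -, -, q, h1, h2⟩ := h j g c hc
  obtain ⟨h3, rfl⟩ := S.reach_iff.1 h1
  exact ⟨h3, fun Y => S.mem_H_iff.2 (h2 Y)⟩

theorem isClopen_agree (S : E.DynSystem) [Finite E.Edge] (n : ℕ) (p : S.Pt) :
    IsClopen {q : S.Pt | S.flow.Agree n q p} := by
  have h : {q : S.Pt | S.flow.Agree n q p} = ⋂ L ∈ {L : List (E.Edge × Bool) | L.length ≤ n},
      {q : S.Pt | S.flow.code q L = S.flow.code p L} := by
    ext q
    simp only [Set.mem_iInter]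
    rfl
  rw [h]
  exact (List.finite_length_le _ n).isClopen_biInter fun L _ => S.isClopen_code_eq L _

/-- The point is the image of the root of the tree. It does not depend on `j`, so the same statement
handles finite and infinite sequences. -/
theorem IsUniversal.exists_realization [Finite E.V0] [Finite E.V1] [Finite E.Edge]
    {S : E.DynSystem} (hS : S.IsUniversal) (w : E.V1) (f : ℕ → E.LocalFun) :
    ∃ ξ : S.Ω (Sum.inr w), ∀ j, Chain w f j → ∀ g c, f j g = some c → S.flow.Body ξ.1 g c := by
  obtain ⟨k, hk⟩ := hS.exists_hom (tree w (treeChoice f))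
  exact ⟨⟨k ⟨[], Valid.nil⟩, S.flow_cls_eq.1 (hk.cls _)⟩, fun j hj g c hc =>
    hk.body (Flow.body_tree hj hc)⟩

/-- A flow of E_n containing all classes is carried into the n-th layer of a flow of E, and from
there into that of `S`. -/
theorem IsUniversal.exists_cls_iter [Finite E.V0] [Finite E.V1] [Finite E.Edge]
    {S : E.DynSystem} (hS : S.IsUniversal) (n : ℕ) (v : (E.seq n).V0 ⊕ (E.seq n).V1) :
    ∃ p, (S.flow.iter n).cls (S.flow.toIter n p) = v := by
  have := E.finite_seq n
  obtain ⟨G, hG⟩ := Flow.exists_cls_surjective (E.seq n)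
  obtain ⟨F, g, hg⟩ := Flow.exists_hom_iter n G
  obtain ⟨k, hk⟩ := hS.exists_hom F
  obtain ⟨k', hk'⟩ := hk.iter n
  obtain ⟨p, rfl⟩ := hG v
  obtain ⟨q, hq⟩ := S.flow.toIter_surjective n (k' (g p))
  exact ⟨q, by rw [hq, hk'.cls, hg.cls]⟩

end DynSystem

theorem exists_equiv_of_surjective {α β γ : Type*} {a : α → β} {b : α → γ}
    (ha : Function.Surjective a) (hb : Function.Surjective b)
    (h : ∀ x y, a x = a y ↔ b x = b y) : ∃ e : β ≃ γ, ∀ x, e (a x) = b x := by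
  refine ⟨Equiv.ofBijective (fun y => b (ha y).choose) ⟨fun y y' hy => ?_, fun z => ?_⟩,
    fun x => (h _ _).1 (ha (a x)).choose_spec⟩
  · rw [← (ha y).choose_spec, ← (ha y').choose_spec]
    exact (h _ _).2 hy
  · obtain ⟨x, rfl⟩ := hb z
    exact ⟨a x, (h _ _).1 (ha (a x)).choose_spec⟩

namespace DynSystem

variable {S : E.DynSystem} {w : E.V1} {Φ : S.Ω (Sum.inr w) → E.EFunction w}

theorem truncate_eq_truncate_iff (hΦ : ∀ ξ j g c, (Φ ξ).f j g = some c → S.flow.Body ξ.1 g c)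
    (r : ℕ) (ξ η : S.Ω (Sum.inr w)) :
    (Φ ξ).truncate r = (Φ η).truncate r ↔ S.flow.Agree (2 * r) ξ.1 η.1 :=
  EFunction.truncate_eq_iff.trans (Flow.forall_eq_iff_agree (S.flow_cls_eq.2 ξ.2)
    (S.flow_cls_eq.2 η.2) (hΦ ξ) (hΦ η) r)

theorem cylinder_truncate (hΦ : ∀ ξ j g c, (Φ ξ).f j g = some c → S.flow.Body ξ.1 g c)
    (r : ℕ) (ξ : S.Ω (Sum.inr w)) :
    S.cylinder Φ ((Φ ξ).truncate r) = {η : S.Pt | S.flow.Agree (2 * r) η ξ.1} := by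
  ext η
  constructor
  · rintro ⟨h, h'⟩
    exact (truncate_eq_truncate_iff hΦ r _ _).1 h'
  · intro h
    have hη : η ∈ S.Ω (Sum.inr w) := S.flow_cls_eq.1 (h.cls_eq.trans (S.flow_cls_eq.2 ξ.2))
    exact ⟨hη, (truncate_eq_truncate_iff hΦ r ⟨η, hη⟩ _).2 h⟩

variable [Finite E.V0] [Finite E.V1] [Finite E.Edge]

theorem IsUniversal.truncate_surjective (hS : S.IsUniversal)
    (hΦ : ∀ ξ j g c, (Φ ξ).f j g = some c → S.flow.Body ξ.1 g c) (r : ℕ) :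
    Function.Surjective fun ξ => (Φ ξ).truncate r := by
  intro 𝔤
  -- The terms from `r` on are padding; no chain condition used below reaches them.
  let f : ℕ → E.LocalFun := fun j => if h : j < r then 𝔤.f ⟨j, h⟩ else fun _ => none
  have hf : ∀ j (h : j < r), f j = 𝔤.f ⟨j, h⟩ := fun j h => dif_pos h
  have hc : ∀ j < r, Chain w f j := fun j hj => by
    refine ⟨?_, fun i hi => ?_⟩
    · rw [hf 0 (by omega)]
      exact 𝔤.first _
    · rw [hf i (by omega), hf (i + 1) (by omega)]
      exact 𝔤.step i _
  obtain ⟨ξ, hξ⟩ := hS.exists_realization w f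
  refine ⟨ξ, EFunction.truncate_eq_iff.2 fun j hj => ?_⟩
  rw [← hf j hj]
  exact Flow.eq_of_chain ((Φ ξ).chain j) (hc j hj) (fun i _ => hΦ ξ i)
    fun i hi => hξ i (hc i (by omega))

theorem IsUniversal.bijective (hS : S.IsUniversal)
    (hΦ : ∀ ξ j g c, (Φ ξ).f j g = some c → S.flow.Body ξ.1 g c) : Function.Bijective Φ := by
  constructor
  · intro ξ η h
    refine Subtype.ext (hS.code_injective (funext fun L => ?_))
    exact (truncate_eq_truncate_iff hΦ L.length ξ η).1 (by rw [h]) L (by omega)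
  · intro 𝔣
    obtain ⟨ξ, hξ⟩ := hS.exists_realization w 𝔣.f
    exact ⟨ξ, EFunction.ext (funext fun j => Flow.eq_of_chain ((Φ ξ).chain j) (𝔣.chain j)
      (fun i _ => hΦ ξ i) fun i _ => hξ i (𝔣.chain i))⟩

theorem IsUniversal.hasBasis (hS : S.IsUniversal) (ξ : S.Pt) :
    (𝓝 ξ).HasBasis (fun r : ℕ => 1 ≤ r) (fun r => {η : S.Pt | S.flow.Agree (2 * r) η ξ}) := by
  refine Filter.hasBasis_iff.2 fun t => ⟨fun ht => ?_, ?_⟩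
  -- The closed sets decrease to {ξ}, since points are determined by their codes; by compactness one
  -- of them lies in the neighbourhood.
  · obtain ⟨r, hr⟩ := exists_subset_nhds_of_compactSpace
      (V := fun r : ℕ => {η : S.Pt | S.flow.Agree (2 * r) η ξ}) (U := t)
      (directed_of_isDirected_le fun m n hmn η h => Flow.Agree.mono (by omega) h)
      (fun r => (S.isClopen_agree (2 * r) ξ).isClosed) (fun η hη => by
        have : η = ξ := hS.code_injective (funext fun L =>
          Set.mem_iInter.1 hη L.length L (by omega))
        rwa [this])
    exact ⟨r + 1, by omega, fun η h => hr (Flow.Agree.mono (by omega) h)⟩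
  · rintro ⟨r, -, hr⟩
    exact Filter.mem_of_superset ((S.isClopen_agree (2 * r) ξ).isOpen.mem_nhds fun _ _ => rfl) hr

theorem IsUniversal.exists_equiv_vertices (hS : S.IsUniversal)
    (hΦ : ∀ ξ j g c, (Φ ξ).f j g = some c → S.flow.Body ξ.1 g c) (r : ℕ) :
    ∃ Ψ : E.PartialEFunction w r ≃ {v : E.D (2 * r + 1) // E.root r v = w},
      ∀ 𝔤 : E.PartialEFunction w r,
        S.cylinder Φ 𝔤 = S.vertexSet ⟨2 * r + 1, (Ψ 𝔤).1⟩ := by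
  choose b hb hb' using fun ξ : S.Ω (Sum.inr w) =>
    S.exists_cls_iter_eq_inl (m := r) (S.flow_cls_eq.2 ξ.2)
  have hsurj : Function.Surjective
      fun ξ => (⟨b ξ, hb ξ⟩ : {v : E.D (2 * r + 1) // E.root r v = w}) := by
    rintro ⟨v, rfl⟩
    obtain ⟨p, hp⟩ := hS.exists_cls_iter (2 * r + 1) (Sum.inl v)
    refine ⟨⟨p, S.flow_cls_eq.1 (S.cls_eq_root r v p hp)⟩, Subtype.ext ?_⟩
    exact Sum.inl_injective ((hb' _).symm.trans hp)
  have hker : ∀ ξ η, (Φ ξ).truncate r = (Φ η).truncate r ↔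
      (⟨b ξ, hb ξ⟩ : {v : E.D (2 * r + 1) // E.root r v = w}) = ⟨b η, hb η⟩ := by
    intro ξ η
    -- D_{2r+1} is E_{2r}^{0,1}, so equality of these vertices is equality of classes in E_{2r},
    -- that is, agreement up to length 2r.
    refine (truncate_eq_truncate_iff hΦ r ξ η).trans
      ((S.flow.cls_iter_eq_iff (2 * r)).symm.trans ?_)
    refine (Iff.of_eq (congrArg₂ Eq ((S.flow.iter (2 * r)).upCls_eq_inl.1 (hb' ξ))
      ((S.flow.iter (2 * r)).upCls_eq_inl.1 (hb' η)))).trans ?_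
    exact Sum.inr_injective.eq_iff.trans ⟨fun h => Subtype.ext h, congrArg Subtype.val⟩
  obtain ⟨Ψ, hΨ⟩ := exists_equiv_of_surjective (hS.truncate_surjective hΦ r) hsurj hker
  refine ⟨Ψ, fun 𝔤 => Set.ext fun η => Iff.trans ?_ (S.mem_layerSet_iff _ _ _).symm⟩
  constructor
  · rintro ⟨h, rfl⟩
    rw [hΨ ⟨η, h⟩]
    exact hb' ⟨η, h⟩
  · intro h
    have hη : η ∈ S.Ω (Sum.inr w) := by
      rw [← S.flow_cls_eq, S.cls_eq_root r _ η h, (Ψ 𝔤).2]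
    refine ⟨hη, Ψ.injective ((hΨ ⟨η, hη⟩).trans (Subtype.ext ?_))⟩
    exact Sum.inl_injective ((hb' ⟨η, hη⟩).symm.trans h)

end DynSystem

end BipSepGraph

theorem theorem8p3 (E : BipSepGraph.{u}) [Finite E.V0] [Finite E.V1] [Finite E.Edge]
    (hE : ∀ v : E.V0, ∃ X Y : E.C, X ≠ Y ∧ E.base X = v ∧ E.base Y = v) :
    (∃ S : E.DynSystem, S.IsUniversal) ∧
    ∀ S : E.DynSystem, S.IsUniversal → ∀ w : E.V1,
      ∃ Φ : S.Ω (Sum.inr w) ≃ E.EFunction w,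
        (∀ ξ : S.Ω (Sum.inr w), S.Records ξ.1 (Φ ξ)) ∧
        (∀ r : ℕ, 1 ≤ r → ∀ 𝔤 : E.PartialEFunction w r, IsClopen (S.cylinder Φ 𝔤)) ∧
        (∀ ξ : S.Ω (Sum.inr w), (𝓝 ξ.1).HasBasis (fun r : ℕ => 1 ≤ r)
          (fun r => S.cylinder Φ ((Φ ξ).truncate r))) ∧
        (∀ r : ℕ, 1 ≤ r →
          ∃ Ψ : E.PartialEFunction w r ≃ {v : E.D (2 * r + 1) // E.root r v = w},
            ∀ 𝔤 : E.PartialEFunction w r,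
              S.cylinder Φ 𝔤 = S.vertexSet ⟨2 * r + 1, (Ψ 𝔤).1⟩) := by
  refine ⟨⟨_, BipSepGraph.CodeSpace.isUniversal_system⟩, fun S hS w => ?_⟩
  choose φ hφ using fun ξ : S.Ω (Sum.inr w) =>
    S.flow.exists_eFunction (p := ξ.1) (S.flow_cls_eq.2 ξ.2)
  refine ⟨Equiv.ofBijective φ (hS.bijective hφ), fun ξ => S.records_of_body (hφ ξ),
    fun r _ 𝔤 => ?_, fun ξ => ?_, fun r _ => hS.exists_equiv_vertices hφ r⟩
  -- Every partial E-function is realized, so every cylinder is the set of points agreeing with some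
  -- ξ.
  · obtain ⟨ξ, rfl⟩ := hS.truncate_surjective hφ r 𝔤
    exact (BipSepGraph.DynSystem.cylinder_truncate hφ r ξ).symm ▸ S.isClopen_agree (2 * r) ξ.1
  · exact (hS.hasBasis ξ.1).congr (fun _ => Iff.rfl)
      fun r _ => (BipSepGraph.DynSystem.cylinder_truncate hφ r ξ).symm
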